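/- Let $A$ be a unital C*-algebra, let $\mathfrak S_3$ be the permutation group of $\{1,2,3\}$ with $\tau=(1\ 2)$ and $\eta=(1\ 2\ 3)$, and let $\alpha$ be an action of $\mathfrak S_3$ on $A$ by $*$-automorphisms. Let $A\rtimes_\alpha\mathfrak S_3$ be the crossed product, i.e. the universal C*-algebra generated by a copy of $A$ and unitaries $U_g$ $(g\in\mathfrak S_3)$ with $U_{gh}=U_gU_h$ and $U_g a U_g^*=\alpha_g(a)$; define $A\rtimes_{\alpha_\eta}\mathbb Z_3$ in the same way for the subgroup $\{1,\eta,\eta^2\}\cong\mathbb Z_3$. Representations are unital $*$-representations on Hilbert spaces, "equivalent" means unitarily equivalent, and an irreducible representation $\pi$ of $A$ is called minimal for the action of $\eta$ if it is the restriction to $A$ of an irreducible representation of $A\rtimes_{\alpha_\eta}\mathbb Z_3$. Operators on a direct sum $\mathcal H_1^{\oplus n}$ are written as $n\times n$ matrices of operators on $\mathcal H_1$. The set $\{\tau,\eta\}$ generates $\mathfrak S_3$. For every irreducible representation $\Pi$ of $A\rtimes_\alpha\mathfrak S_3$, exactly one of the following holds, up to unitary conjugation of $\Pi$. (i) $\Pi$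 is minimal, i.e. $\Pi_{|A}$ is irreducible. (ii) There is an irreducible representation $\pi_1$ of $A$ on a Hilbert space $\mathcal H_1$ such that $\Pi$ acts on $\mathcal H_1\oplus\mathcal H_1$ with $$\Pi_{|A}=\pi_1\oplus\pi_1\circ\alpha_\tau,\qquad \Pi(U_\tau)=\begin{pmatrix}0&1\\1&0\end{pmatrix},$$ and $\pi_1$ and $\pi_1\circ\alpha_\tau$ are both minimal for the action of $\eta$. (iii) There is an irreducible representation $\pi_1$ of $A$ on a Hilbert space $\mathcal H_1$, equivalent neither to $\pi_1\circ\alpha_\eta$ nor to $\pi_1\circ\alpha_{\eta^2}$, such that $\Pi$ acts on $\mathcal H_1^{\oplus 3}$ with $$\Pi_{|A}=\pi_1\oplus\pi_1\circ\alpha_\eta\oplus\pi_1\circ\alpha_{\eta^2},\qquad \Pi(U_\eta)=\begin{pmatrix}0&1&0\\0&0&1\\1&0&0\end{pmatrix}.$$ (iv) There is an irreducible representation $\pi_1$ of $A$ on a Hilbert space $\mathcal H_1$, not equivalent to $\pi_1\circ\alpha_\sigma$ for any $\sigma\in\mathfrak S_3\setminus\{\mathrm{Id}\}$, such that $\Pi$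 acts on $\mathcal H_1^{\oplus 6}$ with $$\Pi_{|A}=\pi_1\oplus\pi_1\circ\alpha_\eta\oplus\pi_1\circ\alpha_{\eta^2}\oplus\pi_1\circ\alpha_\tau\oplus\pi_1\circ\alpha_{\eta\tau}\oplus\pi_1\circ\alpha_{\eta^2\tau},$$ $$\Pi(U_\eta)=\begin{pmatrix}0&1&0&0&0&0\\0&0&1&0&0&0\\1&0&0&0&0&0\\0&0&0&0&0&1\\0&0&0&1&0&0\\0&0&0&0&1&0\end{pmatrix},\qquad \Pi(U_\tau)=\begin{pmatrix}0&0&0&1&0&0\\0&0&0&0&1&0\\0&0&0&0&0&1\\1&0&0&0&0&0\\0&1&0&0&0&0\\0&0&1&0&0&0\end{pmatrix}.$$ In (ii), $\pi_1$ may or may not be equivalent to $\pi_1\circ\alpha_\tau$: there are $A$, $\alpha$ and an irreducible $\Pi$ of type (ii) for which they are equivalent, and others for which they are not. -/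

import Mathlib

universe u v w

noncomputable section

/-! ### Crossed products by finite groups -/

namespace CrossedProduct

variable {A : Type u} [CStarAlgebra A] {G : Type v} [Group G] [DecidableEq G]

/-- The regular copy of `a : A` in the matrix algebra `M_G(A)`: the diagonal matrix with entry
`α x a` at `x`. -/
def diag (α : G →* (A ≃⋆ₐ[ℂ] A)) (a : A) : CStarMatrix G G A :=
  CStarMatrix.ofMatrix fun x y => if x = y then α x a else 0

/-- The regular copy of `g : G` in the matrix algebra `M_G(A)`: the permutation matrix with entry
`1` at `(x, x * g)`. -/
def perm (A : Type u) [CStarAlgebra A] (g : G) : CStarMatrix G G A :=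
  CStarMatrix.ofMatrix fun x y => if x * g = y then 1 else 0

theorem diag_apply (α : G →* (A ≃⋆ₐ[ℂ] A)) (a : A) (x y : G) :
    diag α a x y = if x = y then α x a else 0 := rfl

theorem perm_apply (g x y : G) : perm A g x y = if x * g = y then (1 : A) else 0 := rfl

variable [Fintype G]

/-- The crossed product `A ⋊_α G = ⨁ g, A U^g`, realised inside `M_G(A)` as the star-subalgebra of
all matrices `∑ g, diag α (f g) * perm A g`; the entry of such a matrix at `(x, y)` is
`α x (f (x⁻¹ * y))`. It is a C⋆-algebra (`isClosed_subalgebra`, `cstarAlgebra`) and it is the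
universal one generated by a covariant representation of `(A, α, G)` (`existsUnique_lift`). -/
def subalgebra (α : G →* (A ≃⋆ₐ[ℂ] A)) : StarSubalgebra ℂ (CStarMatrix G G A) where
  carrier := {M | ∃ f : G → A, ∀ x y, M x y = α x (f (x⁻¹ * y))}
  mul_mem' := by
    rintro M N ⟨f, hf⟩ ⟨k, hk⟩
    refine ⟨fun g => ∑ h, f h * α h (k (h⁻¹ * g)), fun x y => ?_⟩
    rw [CStarMatrix.mul_apply, map_sum]
    refine (Fintype.sum_equiv (Equiv.mulLeft x) _ _ fun h => ?_).symm
    simp [hf, hk, mul_assoc]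
  one_mem' := by
    refine ⟨fun g => if g = 1 then 1 else 0, fun x y => ?_⟩
    rw [CStarMatrix.one_apply]
    by_cases h : x = y
    · simp [h]
    · have : x⁻¹ * y ≠ 1 := fun h' => h (inv_mul_eq_one.1 h')
      simp [h, this]
  add_mem' := by
    rintro M N ⟨f, hf⟩ ⟨k, hk⟩
    exact ⟨f + k, fun x y => by simp [hf, hk]⟩
  zero_mem' := ⟨0, fun x y => by simp [CStarMatrix.zero_apply]⟩
  algebraMap_mem' := by
    intro r
    refine ⟨fun g => if g = 1 then algebraMap ℂ A r else 0, fun x y => ?_⟩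
    rw [CStarMatrix.algebraMap_apply]
    by_cases h : x = y
    · subst h
      simp [Algebra.algebraMap_eq_smul_one]
    · have : x⁻¹ * y ≠ 1 := fun h' => h (inv_mul_eq_one.1 h')
      simp [h, this]
  star_mem' := by
    rintro M ⟨f, hf⟩
    refine ⟨fun g => star (α g (f g⁻¹)), fun x y => ?_⟩
    rw [CStarMatrix.star_apply, hf, map_star, ← StarAlgEquiv.mul_apply, ← map_mul]
    simp

end CrossedProduct

/-- The crossed product `A ⋊_α G` of a unital C⋆-algebra by a finite group. -/
abbrev CrossedProduct {A : Type u} [CStarAlgebra A] {G : Type v} [Group G] [Fintype G]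
    [DecidableEq G] (α : G →* (A ≃⋆ₐ[ℂ] A)) : Type (max u v) :=
  ↥(CrossedProduct.subalgebra α)

namespace CrossedProduct

variable {A : Type u} [CStarAlgebra A] {G : Type v} [Group G] [Fintype G] [DecidableEq G]

/-- The canonical copy of `A` in `A ⋊_α G`. -/
def ι (α : G →* (A ≃⋆ₐ[ℂ] A)) : A →⋆ₐ[ℂ] CrossedProduct α where
  toFun a := ⟨diag α a, fun g => if g = 1 then a else 0, fun x y => by
    by_cases h : x = y
    · simp [diag_apply, h]
    · have : x⁻¹ * y ≠ 1 := fun h' => h (inv_mul_eq_one.1 h')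
      simp [diag_apply, h, this]⟩
  map_one' := by
    ext x y
    simp [diag_apply, CStarMatrix.one_apply]
  map_mul' a b := by
    ext x y
    by_cases h : x = y <;> simp [diag_apply, CStarMatrix.mul_apply, h]
  map_zero' := by
    ext x y
    simp [diag_apply, CStarMatrix.zero_apply]
  map_add' a b := by
    ext x y
    by_cases h : x = y <;> simp [diag_apply, h]
  commutes' r := by
    ext x y
    by_cases h : x = y <;>
      simp [diag_apply, h, Algebra.algebraMap_eq_smul_one]
  map_star' a := by
    ext x y
    by_cases h : x = y
    · simp [diag_apply, CStarMatrix.star_apply, h, map_star]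
    · simp [diag_apply, CStarMatrix.star_apply, h, Ne.symm h]

/-- The canonical unitary `U^g` of `A ⋊_α G`. -/
def U (α : G →* (A ≃⋆ₐ[ℂ] A)) (g : G) : CrossedProduct α :=
  ⟨perm A g, fun h => if g = h then 1 else 0, fun x y => by
    by_cases h : x * g = y
    · subst h; simp [perm_apply]
    · have : g ≠ x⁻¹ * y := fun h' => h (by simp [h'])
      simp [perm_apply, h, this]⟩

/-- The crossed product is norm closed in the C⋆-algebra `M_G(A)`. -/
theorem isClosed_subalgebra (α : G →* (A ≃⋆ₐ[ℂ] A)) :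
    IsClosed (subalgebra α : Set (CStarMatrix G G A)) := by
  have h : (subalgebra α : Set (CStarMatrix G G A)) =
      ⋂ x : G, ⋂ y : G, {M | M x y = α x (M 1 (x⁻¹ * y))} := by
    ext M
    simp only [Set.mem_iInter]
    constructor
    · rintro ⟨f, hf⟩ x y
      show M x y = _
      simp [hf]
    · exact fun h => ⟨fun g => M 1 g, h⟩
  rw [h]
  have hc : ∀ x y : G, Continuous fun M : CStarMatrix G G A => M x y := fun x y =>
    (continuous_apply_apply x y : Continuous fun M : G → G → A => M x y)
  refine isClosed_iInter fun x => isClosed_iInter fun y => isClosed_eq (hc _ _) ?_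
  exact (StarAlgEquiv.isometry (α x)).continuous.comp (hc _ _)

/-- The crossed product is a C⋆-algebra. -/
@[reducible]
def cstarAlgebra (α : G →* (A ≃⋆ₐ[ℂ] A)) : CStarAlgebra (CrossedProduct α) :=
  letI := CStarAlgebra.spectralOrder A
  letI := CStarAlgebra.spectralOrderedRing A
  StarSubalgebra.cstarAlgebra (subalgebra α) (h_closed := isClosed_subalgebra α)

theorem coe_ι (α : G →* (A ≃⋆ₐ[ℂ] A)) (a : A) (x y : G) :
    (ι α a : CStarMatrix G G A) x y = if x = y then α x a else 0 := rfl

theorem coe_U (α : G →* (A ≃⋆ₐ[ℂ] A)) (g : G) (x y : G) :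
    (U α g : CStarMatrix G G A) x y = if x * g = y then 1 else 0 := rfl

theorem coe_ι_mul (α : G →* (A ≃⋆ₐ[ℂ] A)) (a : A) (N : CStarMatrix G G A) (x y : G) :
    ((ι α a : CStarMatrix G G A) * N) x y = α x a * N x y := by
  rw [CStarMatrix.mul_apply, Finset.sum_eq_single x]
  · simp [coe_ι]
  · intro z _ hz
    simp [coe_ι, Ne.symm hz]
  · simp

theorem coe_U_mul (α : G →* (A ≃⋆ₐ[ℂ] A)) (g : G) (N : CStarMatrix G G A) (x y : G) :
    ((U α g : CStarMatrix G G A) * N) x y = N (x * g) y := by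
  rw [CStarMatrix.mul_apply, Finset.sum_eq_single (x * g)]
  · simp [coe_U]
  · intro z _ hz
    simp [coe_U, Ne.symm hz]
  · simp

theorem U_one (α : G →* (A ≃⋆ₐ[ℂ] A)) : U α 1 = 1 := by
  ext x y
  simp [coe_U, CStarMatrix.one_apply]

theorem U_mul (α : G →* (A ≃⋆ₐ[ℂ] A)) (g h : G) : U α (g * h) = U α g * U α h := by
  ext x y
  simp [coe_U_mul, coe_U, mul_assoc]

theorem star_U (α : G →* (A ≃⋆ₐ[ℂ] A)) (g : G) : star (U α g) = U α g⁻¹ := by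
  ext x y
  by_cases h : y * g = x
  · subst h
    simp [coe_U, CStarMatrix.star_apply]
  · have : x * g⁻¹ ≠ y := fun h' => h (by simp [← h'])
    simp [coe_U, CStarMatrix.star_apply, h, this]

/-- `U^g a U^{g⁻¹} = α_g(a)`. -/
theorem covariant (α : G →* (A ≃⋆ₐ[ℂ] A)) (g : G) (a : A) :
    U α g * ι α a * U α g⁻¹ = ι α (α g a) := by
  rw [mul_assoc]
  ext x y
  simp [coe_U_mul, coe_ι_mul, coe_U, coe_ι]

theorem coe_apply (α : G →* (A ≃⋆ₐ[ℂ] A)) (M : CrossedProduct α) (x y : G) :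
    (M : CStarMatrix G G A) x y = α x ((M : CStarMatrix G G A) 1 (x⁻¹ * y)) := by
  obtain ⟨M, f, hf⟩ := M
  simp [hf]

/-- Every element of the crossed product is `∑ g, a_g U^g`. -/
theorem eq_sum (α : G →* (A ≃⋆ₐ[ℂ] A)) (M : CrossedProduct α) :
    M = ∑ g, ι α ((M : CStarMatrix G G A) 1 g) * U α g := by
  have key : ∀ (s : Finset G) (F : G → CrossedProduct α) (x y : G),
      ((∑ g ∈ s, F g : CrossedProduct α) : CStarMatrix G G A) x y =
        ∑ g ∈ s, (F g : CStarMatrix G G A) x y := by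
    intro s F x y
    induction s using Finset.induction_on with
    | empty => simp [CStarMatrix.zero_apply]
    | insert a s ha ih =>
      rw [Finset.sum_insert ha, Finset.sum_insert ha, ← ih]
      rfl
  ext x y
  rw [key, Finset.sum_eq_single (x⁻¹ * y)]
  · simp [coe_ι_mul, coe_U, coe_apply α M x y]
  · intro g _ hg
    have : x * g ≠ y := fun h' => hg (by simp [← h'])
    simp [coe_ι_mul, coe_U, this]
  · simp

/-- The universal property: every covariant representation `(π, V)` of `(A, α, G)` on a unital
C⋆-algebra (indeed on any unital complex star-algebra) factors uniquely through `A ⋊_α G`. -/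
theorem existsUnique_lift (α : G →* (A ≃⋆ₐ[ℂ] A)) {B : Type w} [Ring B] [StarRing B]
    [Algebra ℂ B] [StarModule ℂ B] (π : A →⋆ₐ[ℂ] B) (V : G →* unitary B)
    (hV : ∀ g a, (V g : B) * π a * (V g⁻¹ : B) = π (α g a)) :
    ∃! Φ : CrossedProduct α →⋆ₐ[ℂ] B, (∀ a, Φ (ι α a) = π a) ∧ ∀ g, Φ (U α g) = V g := by
  have hVV : ∀ g h, (V (g * h) : B) = V g * V h := fun g h => by simp
  have hc : ∀ g a, (V g : B) * π a = π (α g a) * V g := fun g a => by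
    rw [← hV, mul_assoc _ _ (V g : B), ← hVV]
    simp
  have hs : ∀ g, star (V g : B) = V g⁻¹ := fun g => by
    rw [map_inv, ← Unitary.coe_star, Unitary.star_eq_inv]
  have hone : ∀ c : A, ∑ g, π (if (1 : G) = g then c else 0) * (V g : B) = π c := fun c => by
    rw [Finset.sum_eq_single 1]
    · simp
    · intro g _ hg
      simp [Ne.symm hg]
    · simp
  refine ⟨{ toFun := fun M => ∑ g, π ((M : CStarMatrix G G A) 1 g) * (V g : B)
            map_one' := ?_, map_mul' := ?_, map_zero' := ?_, map_add' := ?_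
            commutes' := ?_, map_star' := ?_ }, ⟨fun a => ?_, fun g => ?_⟩, ?_⟩
  · simp [CStarMatrix.one_apply]
  · intro M N
    have h₁ : ∀ g, π (((M * N : CrossedProduct α) : CStarMatrix G G A) 1 g) =
        ∑ h, π ((M : CStarMatrix G G A) 1 h) * π ((N : CStarMatrix G G A) h g) := fun g => by
      simp [CStarMatrix.mul_apply]
    simp only [h₁]
    rw [Finset.sum_mul_sum]
    simp only [Finset.sum_mul]
    rw [Finset.sum_comm]
    refine Finset.sum_congr rfl fun h _ => ?_
    refine (Fintype.sum_equiv (Equiv.mulLeft h) _ _ fun k => ?_).symm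
    rw [coe_apply α N h]
    simp only [Equiv.coe_mulLeft, inv_mul_cancel_left, hVV]
    rw [mul_assoc, ← mul_assoc (V h : B), hc]
    simp only [mul_assoc]
  · simp [CStarMatrix.zero_apply]
  · intro M N
    simp [add_mul, Finset.sum_add_distrib]
  · intro r
    have h := hone (algebraMap ℂ A r)
    rw [AlgHomClass.commutes] at h
    rw [← h]
    refine Finset.sum_congr rfl fun g _ => ?_
    simp [CStarMatrix.algebraMap_apply]
  · intro M
    rw [star_sum]
    refine Fintype.sum_equiv (Equiv.inv G) _ _ fun g => ?_
    simp only [StarMemClass.coe_star, CStarMatrix.star_apply, Equiv.inv_apply, star_mul, hs,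
      inv_inv, ← map_star]
    rw [coe_apply α M g 1, ← map_star, ← hc]
    simp
  · exact (by simpa [coe_ι] using hone a)
  · change ∑ h, π ((U α g : CStarMatrix G G A) 1 h) * (V h : B) = V g
    rw [Finset.sum_eq_single g]
    · simp [coe_U]
    · intro h _ hg
      simp [coe_U, Ne.symm hg]
    · simp
  · rintro Ψ ⟨h₁, h₂⟩
    ext M
    conv_lhs => rw [eq_sum α M]
    simp [h₁, h₂]

end CrossedProduct

/-! ### Representations -/

/-- Representations of a unital star-algebra `B` on a Hilbert space `H`, i.e. unital
star-homomorphisms into the bounded operators on `H`. -/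
abbrev StarRep (B : Type u) [Semiring B] [Star B] [Algebra ℂ B] (H : Type v)
    [NormedAddCommGroup H] [InnerProductSpace ℂ H] [CompleteSpace H] : Type (max u v) :=
  B →⋆ₐ[ℂ] (H →L[ℂ] H)

namespace StarRep

variable {B : Type u} [Semiring B] [Star B] [Algebra ℂ B]
  {H : Type v} [NormedAddCommGroup H] [InnerProductSpace ℂ H] [CompleteSpace H]
  {K : Type w} [NormedAddCommGroup K] [InnerProductSpace ℂ K] [CompleteSpace K]

/-- Topological irreducibility: `H ≠ 0`, and `0` and `H` are the only closed invariant
subspaces. -/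
def IsIrreducible (π : StarRep B H) : Prop :=
  Nontrivial H ∧ ∀ S : Submodule ℂ H, IsClosed (S : Set H) →
    (∀ b, ∀ ξ ∈ S, π b ξ ∈ S) → S = ⊥ ∨ S = ⊤

/-- Unitary equivalence. -/
def UnitarilyEquiv (π : StarRep B H) (ρ : StarRep B K) : Prop :=
  ∃ W : H ≃ₗᵢ[ℂ] K, ∀ b ξ, W (π b ξ) = ρ b (W ξ)

/-- `ρ = π₁ ⊕ ⋯ ⊕ πₙ` on the Hilbert space direct sum of `n` copies of `H`. -/
def IsDirectSum {n : ℕ} (ρ : StarRep B (PiLp 2 fun _ : Fin n => H)) (π : Fin n → StarRep B H) :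
    Prop :=
  ∀ b ξ i, ρ b ξ i = π i b (ξ i)

end StarRep

/-- The operator `T` on the direct sum of `n` copies of `H` is given by the scalar matrix `M`, a
scalar standing for the corresponding multiple of the identity of `H`. -/
def HasMatrix {H : Type v} [NormedAddCommGroup H] [InnerProductSpace ℂ H] {n : ℕ}
    (T : (PiLp 2 fun _ : Fin n => H) →L[ℂ] (PiLp 2 fun _ : Fin n => H))
    (M : Matrix (Fin n) (Fin n) ℂ) : Prop :=
  ∀ ξ i, T ξ i = ∑ j, M i j • ξ j

section Action

variable {A : Type u} [CStarAlgebra A] {G : Type v} [Group G]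
  {H : Type w} [NormedAddCommGroup H] [InnerProductSpace ℂ H] [CompleteSpace H]

/-- The representation `π ∘ α_g`. -/
def StarRep.twist (α : G →* (A ≃⋆ₐ[ℂ] A)) (π : StarRep A H) (g : G) : StarRep A H :=
  π.comp (α g : A →⋆ₐ[ℂ] A)

variable [Fintype G] [DecidableEq G]

/-- The restriction to `A` of a representation of `A ⋊_α G`. -/
def StarRep.restrict {α : G →* (A ≃⋆ₐ[ℂ] A)} (Φ : StarRep (CrossedProduct α) H) : StarRep A H :=
  StarAlgHom.comp Φ (CrossedProduct.ι α)

/-- An irreducible representation of `A ⋊_α G` is minimal if its restriction to `A` is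
irreducible. -/
def IsMinimal {α : G →* (A ≃⋆ₐ[ℂ] A)} (Φ : StarRep (CrossedProduct α) H) : Prop :=
  Φ.IsIrreducible ∧ Φ.restrict.IsIrreducible

/-- An irreducible representation `π` of `A` is minimal for the action `α` if it is the restriction
of an irreducible representation of `A ⋊_α G`. -/
def IsMinimalFor (α : G →* (A ≃⋆ₐ[ℂ] A)) (π : StarRep A H) : Prop :=
  π.IsIrreducible ∧ ∃ Ψ : StarRep (CrossedProduct α) H, Ψ.IsIrreducible ∧ Ψ.restrict = π

end Action

/-! ### The permutation group on three elements -/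

/-- The group `𝔖₃`. -/
abbrev S3 : Type := Equiv.Perm (Fin 3)

/-- The transposition `(1 2)`. -/
def τ : S3 := Equiv.swap 0 1

/-- The cycle `(1 2 3)`. -/
def η : S3 := finRotate 3

section Types

variable {A : Type u} [CStarAlgebra A]

/-- The restriction of an action of `𝔖₃` to the cyclic subgroup of order three generated
by `η`. -/
def cyclicAction (α : S3 →* (A ≃⋆ₐ[ℂ] A)) : Subgroup.zpowers η →* (A ≃⋆ₐ[ℂ] A) :=
  α.comp (Subgroup.zpowers η).subtype

variable {α : S3 →* (A ≃⋆ₐ[ℂ] A)}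
  {H : Type v} [NormedAddCommGroup H] [InnerProductSpace ℂ H] [CompleteSpace H]
  {H₁ : Type v} [NormedAddCommGroup H₁] [InnerProductSpace ℂ H₁] [CompleteSpace H₁]

/-- Up to unitary conjugation `Φ` acts on `H₁ ⊕ H₁`, with restriction `π₁ ⊕ π₁ ∘ α_τ` to `A` and
with `U_τ` acting as the flip; moreover `π₁` and `π₁ ∘ α_τ` are minimal for the action of `η`. -/
def IsTypeTwoFrom (Φ : StarRep (CrossedProduct α) H) (π₁ : StarRep A H₁) : Prop :=
  π₁.IsIrreducible ∧
  (∃ Φ' : StarRep (CrossedProduct α) (PiLp 2 fun _ : Fin 2 => H₁),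
    Φ.UnitarilyEquiv Φ' ∧
    Φ'.restrict.IsDirectSum ![π₁, π₁.twist α τ] ∧
    HasMatrix (Φ' (CrossedProduct.U α τ)) !![0, 1; 1, 0]) ∧
  IsMinimalFor (cyclicAction α) π₁ ∧ IsMinimalFor (cyclicAction α) (π₁.twist α τ)

/-- Up to unitary conjugation `Φ` acts on `H₁ ⊕ H₁ ⊕ H₁`, with restriction
`π₁ ⊕ π₁ ∘ α_η ⊕ π₁ ∘ α_{η²}` to `A` and with `U_η` acting as the cyclic shift, where `π₁` is
equivalent neither to `π₁ ∘ α_η` nor to `π₁ ∘ α_{η²}`. -/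
def IsTypeThreeFrom (Φ : StarRep (CrossedProduct α) H) (π₁ : StarRep A H₁) : Prop :=
  π₁.IsIrreducible ∧
  ¬ π₁.UnitarilyEquiv (π₁.twist α η) ∧ ¬ π₁.UnitarilyEquiv (π₁.twist α (η ^ 2)) ∧
  ∃ Φ' : StarRep (CrossedProduct α) (PiLp 2 fun _ : Fin 3 => H₁),
    Φ.UnitarilyEquiv Φ' ∧
    Φ'.restrict.IsDirectSum ![π₁, π₁.twist α η, π₁.twist α (η ^ 2)] ∧
    HasMatrix (Φ' (CrossedProduct.U α η)) !![0, 1, 0; 0, 0, 1; 1, 0, 0]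

/-- Up to unitary conjugation `Φ` acts on the sum of six copies of `H₁` as the regular
representation induced by `π₁`, where `π₁` has trivial stabilizer. -/
def IsTypeSixFrom (Φ : StarRep (CrossedProduct α) H) (π₁ : StarRep A H₁) : Prop :=
  π₁.IsIrreducible ∧
  (∀ σ : S3, σ ≠ 1 → ¬ π₁.UnitarilyEquiv (π₁.twist α σ)) ∧
  ∃ Φ' : StarRep (CrossedProduct α) (PiLp 2 fun _ : Fin 6 => H₁),
    Φ.UnitarilyEquiv Φ' ∧
    Φ'.restrict.IsDirectSum ![π₁, π₁.twist α η, π₁.twist α (η ^ 2),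
      π₁.twist α τ, π₁.twist α (η * τ), π₁.twist α (η ^ 2 * τ)] ∧
    HasMatrix (Φ' (CrossedProduct.U α η))
      !![0, 1, 0, 0, 0, 0;
         0, 0, 1, 0, 0, 0;
         1, 0, 0, 0, 0, 0;
         0, 0, 0, 0, 0, 1;
         0, 0, 0, 1, 0, 0;
         0, 0, 0, 0, 1, 0] ∧
    HasMatrix (Φ' (CrossedProduct.U α τ))
      !![0, 0, 0, 1, 0, 0;
         0, 0, 0, 0, 1, 0;
         0, 0, 0, 0, 0, 1;
         1, 0, 0, 0, 0, 0;
         0, 1, 0, 0, 0, 0;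
         0, 0, 1, 0, 0, 0]

def IsTypeTwo (Φ : StarRep (CrossedProduct α) H) : Prop :=
  ∃ (H₁ : Type v) (_ : NormedAddCommGroup H₁) (_ : InnerProductSpace ℂ H₁) (_ : CompleteSpace H₁)
    (π₁ : StarRep A H₁), IsTypeTwoFrom Φ π₁

def IsTypeThree (Φ : StarRep (CrossedProduct α) H) : Prop :=
  ∃ (H₁ : Type v) (_ : NormedAddCommGroup H₁) (_ : InnerProductSpace ℂ H₁) (_ : CompleteSpace H₁)
    (π₁ : StarRep A H₁), IsTypeThreeFrom Φ π₁

def IsTypeSix (Φ : StarRep (CrossedProduct α) H) : Prop :=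
  ∃ (H₁ : Type v) (_ : NormedAddCommGroup H₁) (_ : InnerProductSpace ℂ H₁) (_ : CompleteSpace H₁)
    (π₁ : StarRep A H₁), IsTypeSixFrom Φ π₁

end Types

end

/-! Mackey's analysis for a finite group, made concrete for the symmetric group on three letters.

An irreducible `Φ` of the crossed product contains an irreducible `π` of `A`. For a closed
`A`-invariant subspace with projection `P`, the average `∑ U_g⁻¹ P U_g` commutes with the crossed
product, so it is a scalar `c ≥ 0`. Passing to a proper closed invariant subspace lowers `c` by at
least 1. Descending chains are therefore finite and minimal invariant subspaces exist
(`exists_minimal_invariant_subspace`).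

Let `J` embed `π` in `Φ|A`. Then `U_g⁻¹ J` embeds `π ∘ α_g`, and embeddings of inequivalent
irreducibles have orthogonal ranges. If `π` is equivalent to `π ∘ α_g`, the embedding can be
rechosen so that `U_g` preserves its range: it is an eigenvector of a finite-order operation, up to
scalars, on intertwiners (`exists_mem_rangeStabilizer`). Whenever orthogonal translates of the range
are permuted by the group, they fill the whole space by irreducibility (`exists_isDirectSum`).

The type depends on which twists are equivalent to `π`. If none is, the six translates give (iv). If
a transposition fixes the class of `π` but `η` does not, a range invariant under the transposition
has three translates, giving (iii). If `η` fixes the class, a range invariant under `U_η` is taken: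
when it is orthogonal to its image under `U_τ` the result is (ii), and otherwise a combination of
`J` and `U_τ J T`, with `T = J* U_τ J`, is an embedding invariant under the whole group, giving (i).

The types exclude each other because the commutant of `Φ|A` has dimension 1 in (i), 2 or 4 in (ii),
3 in (iii) and 6 in (iv). Both possibilities in (ii) occur: for `A = ℂ` with the two-dimensional
irreducible representation of the group, and for `A = ℂ²` flipped by odd permutations. -/

noncomputable section

/-! ### Schur's lemma -/

namespace StarRep

section Schur

variable {B : Type u} [Semiring B] [StarRing B] [Algebra ℂ B]
  {H : Type v} [NormedAddCommGroup H] [InnerProductSpace ℂ H] [CompleteSpace H]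
  {K : Type w} [NormedAddCommGroup K] [InnerProductSpace ℂ K] [CompleteSpace K]
  {L : Type*} [NormedAddCommGroup L] [InnerProductSpace ℂ L] [CompleteSpace L]

/-- The space of bounded operators intertwining two representations. -/
def intertwiners (π : StarRep B H) (ρ : StarRep B K) : Submodule ℂ (H →L[ℂ] K) where
  carrier := {T | ∀ b ξ, T (π b ξ) = ρ b (T ξ)}
  add_mem' hS hT b ξ := by simp [hS b ξ, hT b ξ]
  zero_mem' b ξ := by simp
  smul_mem' c T hT b ξ := by simp [hT b ξ]

variable {π : StarRep B H} {ρ : StarRep B K} {σ : StarRep B L}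

theorem mem_intertwiners {T : H →L[ℂ] K} :
    T ∈ intertwiners π ρ ↔ ∀ b ξ, T (π b ξ) = ρ b (T ξ) := Iff.rfl

theorem comp_mem_intertwiners {T : K →L[ℂ] L} {S : H →L[ℂ] K} (hT : T ∈ intertwiners ρ σ)
    (hS : S ∈ intertwiners π ρ) : T ∘L S ∈ intertwiners π σ := fun b ξ => by
  simp [hS b ξ, hT b]

theorem adjoint_mem_intertwiners {T : H →L[ℂ] K} (hT : T ∈ intertwiners π ρ) :
    ContinuousLinearMap.adjoint T ∈ intertwiners ρ π := fun b ξ => by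
  refine ext_inner_left ℂ fun ζ => ?_
  rw [ContinuousLinearMap.adjoint_inner_right, ← ContinuousLinearMap.adjoint_inner_left (ρ b),
    ← ContinuousLinearMap.adjoint_inner_left (π b), ContinuousLinearMap.adjoint_inner_right,
    ← ContinuousLinearMap.star_eq_adjoint, ← ContinuousLinearMap.star_eq_adjoint, ← map_star,
    ← map_star, hT]

/-- If `T * S = 0` and `S` commutes with an irreducible representation, then `T` or `S`
vanishes. -/
theorem IsIrreducible.eq_zero_or_eq_zero (hπ : π.IsIrreducible) {S T : H →L[ℂ] H}
    (hS : S ∈ intertwiners π π) (hST : T * S = 0) : T = 0 ∨ S = 0 := by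
  refine (hπ.2 (LinearMap.range (S : H →ₗ[ℂ] H)).topologicalClosure
    (Submodule.isClosed_topologicalClosure _) ?_).symm.imp (fun h => ?_) fun h => ?_
  · intro b ξ hξ
    refine map_mem_closure (π b).continuous hξ ?_
    rintro _ ⟨ζ, rfl⟩
    exact ⟨π b ζ, hS b ζ⟩
  · have hle : (LinearMap.range (S : H →ₗ[ℂ] H)).topologicalClosure ≤
        LinearMap.ker (T : H →ₗ[ℂ] H) := by
      refine Submodule.topologicalClosure_minimal _ ?_ T.isClosed_ker
      rintro _ ⟨ζ, rfl⟩
      exact congr($hST ζ)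
    ext ξ
    exact hle (h ▸ Submodule.mem_top)
  · ext ξ
    have : S ξ ∈ (LinearMap.range (S : H →ₗ[ℂ] H)).topologicalClosure :=
      Submodule.le_topologicalClosure _ ⟨ξ, rfl⟩
    rwa [h] at this

/-- The spectrum is a single point. If it contained `x < y` with midpoint `m`, the functions `(t -
m)⁺` and `(m - t)⁺` of `T` would be nonzero elements of the commutant with product zero,
contradicting `eq_zero_or_eq_zero`. -/
theorem IsIrreducible.exists_eq_smul_of_isSelfAdjoint (hπ : π.IsIrreducible) {T : H →L[ℂ] H}
    (hT : T ∈ intertwiners π π) (hsa : IsSelfAdjoint T) : ∃ c : ℝ, T = (c : ℂ) • 1 := by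
  have := hπ.1
  have hcfc : ∀ f : ℝ → ℝ, cfc f T ∈ intertwiners π π := fun f b ξ => by
    have hc : Commute T (π b) := by
      ext ξ
      exact hT b ξ
    exact congr($(hc.cfc_real f) ξ)
  obtain ⟨c, hc⟩ : (spectrum ℝ T).Nonempty := ContinuousFunctionalCalculus.spectrum_nonempty T hsa
  have huniq : ∀ x ∈ spectrum ℝ T, ∀ y ∈ spectrum ℝ T, ¬ x < y := by
    intro x hx y hy hxy
    have hz : cfc (fun t : ℝ => max (t - (x + y) / 2) 0) T *
        cfc (fun t : ℝ => max ((x + y) / 2 - t) 0) T = 0 := by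
      rw [← cfc_mul _ _ T (by fun_prop) (by fun_prop), ← cfc_const_zero ℝ T]
      refine cfc_congr fun t _ => ?_
      rcases le_total t ((x + y) / 2) with h | h
      · simp [max_eq_right (sub_nonpos.2 h)]
      · simp [max_eq_right (sub_nonpos.2 h)]
    rcases hπ.eq_zero_or_eq_zero (hcfc _) hz with h | h
    · rw [← cfc_const_zero ℝ T] at h
      have := eqOn_of_cfc_eq_cfc h (by fun_prop) (by fun_prop) hsa hy
      have := le_max_left (y - (x + y) / 2) 0
      simp only at *
      linarith
    · rw [← cfc_const_zero ℝ T] at h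
      have := eqOn_of_cfc_eq_cfc h (by fun_prop) (by fun_prop) hsa hx
      have := le_max_left ((x + y) / 2 - x) 0
      simp only at *
      linarith
  refine ⟨c, ?_⟩
  calc T = cfc (fun x : ℝ => x) T := (cfc_id' ℝ T hsa).symm
    _ = cfc (fun _ : ℝ => c) T := cfc_congr fun x hx =>
      le_antisymm (not_lt.1 (huniq c hc x hx)) (not_lt.1 (huniq x hx c hc))
    _ = algebraMap ℝ (H →L[ℂ] H) c := cfc_const c T hsa
    _ = (c : ℂ) • 1 := by
      rw [Algebra.algebraMap_eq_smul_one]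
      ext ξ
      simp

/-- Schur's lemma: the commutant of an irreducible representation consists of scalars. -/
theorem IsIrreducible.exists_eq_smul (hπ : π.IsIrreducible) {T : H →L[ℂ] H}
    (hT : T ∈ intertwiners π π) : ∃ c : ℂ, T = c • 1 := by
  have hT' : star T ∈ intertwiners π π := adjoint_mem_intertwiners hT
  -- Reduction to the self-adjoint case through (twice) the real part and a multiple of the
  -- imaginary part of `T`.
  obtain ⟨x, hx⟩ := hπ.exists_eq_smul_of_isSelfAdjoint (T := T + star T)
    (Submodule.add_mem _ hT hT') (IsSelfAdjoint.add_star_self T)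
  obtain ⟨y, hy⟩ := hπ.exists_eq_smul_of_isSelfAdjoint (T := Complex.I • (T - star T))
    (Submodule.smul_mem _ _ (Submodule.sub_mem _ hT hT')) (by
      rw [IsSelfAdjoint, star_smul, star_sub, star_star]
      simp only [smul_sub, RCLike.star_def, Complex.conj_I, neg_smul]
      abel)
  refine ⟨(x - Complex.I * y) / 2, ?_⟩
  have h2 : (2 : ℂ) • T = (T + star T) + -Complex.I • (Complex.I • (T - star T)) := by
    rw [smul_smul]
    simp [two_smul]
  rw [hx, hy, smul_smul, ← add_smul] at h2
  have : T = (2 : ℂ)⁻¹ • ((2 : ℂ) • T) := by simp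
  rw [this, h2, smul_smul]
  congr 1
  ring

/-- A nonzero operator intertwining an irreducible representation with any other one is a positive
multiple of an isometry. -/
theorem IsIrreducible.exists_isometry (hπ : π.IsIrreducible) {T : H →L[ℂ] K}
    (hT : T ∈ intertwiners π ρ) (h0 : T ≠ 0) :
    ∃ (c : ℝ) (J : H →ₗᵢ[ℂ] K), 0 < c ∧ (J.toContinuousLinearMap ∈ intertwiners π ρ) ∧
      ∀ ξ, T ξ = (c : ℂ) • J ξ := by
  obtain ⟨c, hc⟩ := hπ.exists_eq_smul_of_isSelfAdjoint
    (comp_mem_intertwiners (adjoint_mem_intertwiners hT) hT) (by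
      rw [IsSelfAdjoint, ContinuousLinearMap.star_eq_adjoint, ContinuousLinearMap.adjoint_comp,
        ContinuousLinearMap.adjoint_adjoint])
  have hn : ∀ ξ, ‖T ξ‖ ^ 2 = c * ‖ξ‖ ^ 2 := fun ξ => by
    have h1 : inner ℂ ξ ((ContinuousLinearMap.adjoint T ∘L T) ξ) =
        inner ℂ ξ (((c : ℂ) • 1 : H →L[ℂ] H) ξ) := by
      rw [hc]
    rw [ContinuousLinearMap.comp_apply, ContinuousLinearMap.adjoint_inner_right,
      inner_self_eq_norm_sq_to_K] at h1
    simp only [smul_apply, one_apply_eq_self, inner_smul_right, inner_self_eq_norm_sq_to_K] at h1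
    have h2 : (‖T ξ‖ : ℂ) ^ 2 = c * (‖ξ‖ : ℂ) ^ 2 := h1
    exact_mod_cast h2
  obtain ⟨ξ₀, h₀⟩ : ∃ ξ, T ξ ≠ 0 := by
    by_contra! h
    exact h0 (by ext ξ; exact h ξ)
  have hcpos : 0 < c := by
    have h1 : 0 < c * ‖ξ₀‖ ^ 2 := by
      rw [← hn]
      positivity
    exact pos_of_mul_pos_left h1 (by positivity)
  have hs : (Real.sqrt c : ℂ) ≠ 0 := by
    exact_mod_cast (Real.sqrt_pos.2 hcpos).ne'
  refine ⟨Real.sqrt c, ⟨(((Real.sqrt c : ℂ)⁻¹ • T : H →L[ℂ] K) : H →ₗ[ℂ] K), fun ξ => ?_⟩,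
    Real.sqrt_pos.2 hcpos, ?_, fun ξ => ?_⟩
  · have : ‖T ξ‖ = Real.sqrt c * ‖ξ‖ := by
      rw [← Real.sqrt_sq (norm_nonneg (T ξ)), hn, Real.sqrt_mul hcpos.le,
        Real.sqrt_sq (norm_nonneg ξ)]
    have hs' := (Real.sqrt_pos.2 hcpos).ne'
    simp [norm_smul, this, abs_of_pos (Real.sqrt_pos.2 hcpos)]
    field_simp
  · exact Submodule.smul_mem _ (Real.sqrt c : ℂ)⁻¹ hT
  · simp [smul_smul, hs]

/-- An isometry with range invariant under an irreducible representation is unitary. -/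
theorem IsIrreducible.exists_equiv (hρ : ρ.IsIrreducible) [Nontrivial H] (J : H →ₗᵢ[ℂ] K)
    (hJ : ∀ b ξ, ∃ ζ, ρ b (J ξ) = J ζ) : ∃ W : H ≃ₗᵢ[ℂ] K, ∀ ξ, W ξ = J ξ := by
  have hsurj : Function.Surjective J := by
    have := hρ.2 (LinearMap.range J.toLinearMap) J.isometry.isClosedEmbedding.isClosed_range (by
      rintro b _ ⟨ξ, rfl⟩
      obtain ⟨ζ, hζ⟩ := hJ b ξ
      exact ⟨ζ, hζ.symm⟩)
    rcases this with h | h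
    · obtain ⟨ξ, hξ⟩ := exists_ne (0 : H)
      have : J ξ ∈ LinearMap.range J.toLinearMap := ⟨ξ, rfl⟩
      rw [h, Submodule.mem_bot] at this
      exact absurd (J.injective (this.trans (map_zero J).symm)) hξ
    · exact fun ζ => by simpa using (h ▸ Submodule.mem_top : ζ ∈ LinearMap.range J.toLinearMap)
  exact ⟨LinearIsometryEquiv.ofSurjective J hsurj, fun _ => rfl⟩

/-- After rescaling to an isometry, the range is closed and invariant, hence everything. -/
theorem IsIrreducible.unitarilyEquiv (hπ : π.IsIrreducible) (hρ : ρ.IsIrreducible)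
    {T : H →L[ℂ] K} (hT : T ∈ intertwiners π ρ) (h0 : T ≠ 0) : π.UnitarilyEquiv ρ := by
  have := hπ.1
  obtain ⟨c, J, -, hJ, -⟩ := hπ.exists_isometry hT h0
  obtain ⟨W, hW⟩ := hρ.exists_equiv J fun b ξ => ⟨π b ξ, (hJ b ξ).symm⟩
  exact ⟨W, fun b ξ => by rw [hW, hW]; exact hJ b ξ⟩

theorem UnitarilyEquiv.symm (h : π.UnitarilyEquiv ρ) : ρ.UnitarilyEquiv π := by
  obtain ⟨W, hW⟩ := h
  exact ⟨W.symm, fun b ξ => by rw [W.symm_apply_eq, hW, W.apply_symm_apply]⟩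

theorem UnitarilyEquiv.isIrreducible (h : π.UnitarilyEquiv ρ) (hπ : π.IsIrreducible) :
    ρ.IsIrreducible := by
  obtain ⟨W, hW⟩ := h
  have := hπ.1
  refine ⟨W.symm.toEquiv.nontrivial, fun S hS hinv => ?_⟩
  refine (hπ.2 (S.comap (W : H →ₗ[ℂ] K)) (hS.preimage W.continuous) fun b ξ hξ => ?_).imp
    (fun h => ?_) fun h => ?_
  · have : W (π b ξ) ∈ S := by
      rw [hW]
      exact hinv b _ hξ
    exact this
  · rw [eq_bot_iff] at h ⊢
    intro ζ hζ
    have : W.symm ζ ∈ (⊥ : Submodule ℂ H) := h (by simpa using hζ)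
    simpa using this
  · rw [eq_top_iff] at h ⊢
    intro ζ _
    have : W.symm ζ ∈ S.comap (W : H →ₗ[ℂ] K) := h Submodule.mem_top
    simpa using this

/-! ### Subrepresentations -/

/-- The subrepresentation carried by the range of an isometry. -/
def compress (ρ : StarRep B K) (J : H →ₗᵢ[ℂ] K) (hJ : ∀ b ξ, ∃ ζ, ρ b (J ξ) = J ζ) :
    StarRep B H :=
  have hadj : ∀ ξ, ContinuousLinearMap.adjoint J.toContinuousLinearMap (J ξ) = ξ := fun ξ =>
    ext_inner_left ℂ fun ζ => by
      rw [ContinuousLinearMap.adjoint_inner_right]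
      exact J.inner_map_map ζ ξ
  have hJJ : ∀ b ξ, J (ContinuousLinearMap.adjoint J.toContinuousLinearMap (ρ b (J ξ))) =
      ρ b (J ξ) := fun b ξ => by
    obtain ⟨ζ, hζ⟩ := hJ b ξ
    rw [hζ, hadj]
  { toFun := fun b => ContinuousLinearMap.adjoint J.toContinuousLinearMap ∘L ρ b ∘L
      J.toContinuousLinearMap
    map_one' := by
      ext ξ
      simp [hadj]
    map_mul' := fun b c => by
      ext ξ
      simp [hJJ]
    map_zero' := by
      ext ξ
      simp
    map_add' := fun b c => by
      ext ξ
      simp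
    commutes' := fun r => by
      ext ξ
      simp [hadj, Algebra.algebraMap_eq_smul_one]
    map_star' := fun b => by
      simp [ContinuousLinearMap.star_eq_adjoint, ContinuousLinearMap.adjoint_comp, map_star,
        ContinuousLinearMap.comp_assoc] }

theorem compress_apply (ρ : StarRep B K) (J : H →ₗᵢ[ℂ] K) (hJ : ∀ b ξ, ∃ ζ, ρ b (J ξ) = J ζ)
    (b : B) (ξ : H) : J (ρ.compress J hJ b ξ) = ρ b (J ξ) := by
  obtain ⟨ζ, hζ⟩ := hJ b ξ
  change J (ContinuousLinearMap.adjoint J.toContinuousLinearMap (ρ b (J ξ))) = _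
  rw [hζ]
  congr 1
  refine ext_inner_left ℂ fun ζ' => ?_
  rw [ContinuousLinearMap.adjoint_inner_right]
  exact J.inner_map_map ζ' ζ

/-- The subrepresentation on a closed invariant subspace is irreducible if the subspace is
minimal. -/
theorem isIrreducible_compress_subtype (ρ : StarRep B K) (S : Submodule ℂ K) [CompleteSpace S]
    (hS : ∀ b (ξ : S), ∃ ζ : S, ρ b (S.subtypeₗᵢ ξ) = S.subtypeₗᵢ ζ) (h0 : S ≠ ⊥)
    (hmin : ∀ T : Submodule ℂ K, IsClosed (T : Set K) → (∀ b, ∀ ξ ∈ T, ρ b ξ ∈ T) → T ≤ S →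
      T ≠ ⊥ → T = S) : (ρ.compress S.subtypeₗᵢ hS).IsIrreducible := by
  refine ⟨Submodule.nontrivial_iff_ne_bot.2 h0, fun T hT hinv => ?_⟩
  by_cases hT0 : T = ⊥
  · exact .inl hT0
  right
  have hScl : IsClosed (S : Set K) := (completeSpace_coe_iff_isComplete.1 ‹_›).isClosed
  have := hmin (T.map S.subtype) (by
      rw [Submodule.map_coe]
      exact hScl.isClosedEmbedding_subtypeVal.isClosedMap _ hT) (by
      rintro b _ ⟨ξ, hξ, rfl⟩
      exact ⟨_, hinv b ξ hξ, ρ.compress_apply S.subtypeₗᵢ hS b ξ⟩) (Submodule.map_subtype_le _ _)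
      (fun h => hT0 <| Submodule.map_injective_of_injective S.injective_subtype
        (h.trans (Submodule.map_bot _).symm))
  rw [eq_top_iff]
  intro ξ _
  obtain ⟨ζ, hζ, h⟩ : (ξ : K) ∈ T.map S.subtype := by
    rw [this]
    exact ξ.2
  rwa [← Subtype.ext h]

end Schur

end StarRep

/-! ### Covariance and translates -/

namespace StarRep

section Twist

variable {A : Type u} [CStarAlgebra A] {G : Type w} [Group G] {α : G →* (A ≃⋆ₐ[ℂ] A)}
  {H₁ : Type v} [NormedAddCommGroup H₁] [InnerProductSpace ℂ H₁] [CompleteSpace H₁]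
  {π : StarRep A H₁}

theorem twist_one (π : StarRep A H₁) (α : G →* (A ≃⋆ₐ[ℂ] A)) : π.twist α 1 = π := by
  ext a ξ
  simp [StarRep.twist]

theorem IsIrreducible.twist (hπ : π.IsIrreducible) (α : G →* (A ≃⋆ₐ[ℂ] A)) (g : G) :
    (π.twist α g).IsIrreducible := by
  refine ⟨hπ.1, fun S hS hinv => hπ.2 S hS fun a ξ hξ => ?_⟩
  have : π.twist α g ((α g).symm a) ξ ∈ S := hinv _ ξ hξ
  simpa [StarRep.twist] using this

/-- The same unitary works, after substituting `α_g⁻¹(a)` for `a`. -/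
theorem UnitarilyEquiv.twist_mul_inv {g h : G}
    (e : (π.twist α g).UnitarilyEquiv (π.twist α h)) :
    π.UnitarilyEquiv (π.twist α (h * g⁻¹)) := by
  obtain ⟨W, hW⟩ := e
  refine ⟨W, fun a ξ => ?_⟩
  have := hW (α g⁻¹ a) ξ
  simpa [StarRep.twist, ← StarAlgEquiv.mul_apply] using this

end Twist

section Translate

variable {A : Type u} [CStarAlgebra A] {G : Type w} [Group G] [Fintype G] [DecidableEq G]
  {α : G →* (A ≃⋆ₐ[ℂ] A)}
  {H : Type v} [NormedAddCommGroup H] [InnerProductSpace ℂ H] [CompleteSpace H]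
  {K : Type*} [NormedAddCommGroup K] [InnerProductSpace ℂ K] [CompleteSpace K]
  {Φ : StarRep (CrossedProduct α) H} {Ψ : StarRep (CrossedProduct α) K}

theorem U_mul_apply (Φ : StarRep (CrossedProduct α) H) (g h : G) (ξ : H) :
    Φ (CrossedProduct.U α g) (Φ (CrossedProduct.U α h) ξ) = Φ (CrossedProduct.U α (g * h)) ξ := by
  rw [CrossedProduct.U_mul, map_mul]
  rfl

theorem U_one_apply (Φ : StarRep (CrossedProduct α) H) (ξ : H) :
    Φ (CrossedProduct.U α 1) ξ = ξ := by
  rw [CrossedProduct.U_one, map_one]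
  rfl

theorem U_inner_left (Φ : StarRep (CrossedProduct α) H) (g : G) (ξ ζ : H) :
    inner ℂ (Φ (CrossedProduct.U α g) ξ) ζ = inner ℂ ξ (Φ (CrossedProduct.U α g⁻¹) ζ) := by
  rw [← CrossedProduct.star_U, map_star, ContinuousLinearMap.star_eq_adjoint,
    ContinuousLinearMap.adjoint_inner_right]

theorem norm_U_apply (Φ : StarRep (CrossedProduct α) H) (g : G) (ξ : H) :
    ‖Φ (CrossedProduct.U α g) ξ‖ = ‖ξ‖ := by
  rw [@norm_eq_sqrt_re_inner ℂ, @norm_eq_sqrt_re_inner ℂ, U_inner_left, U_mul_apply,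
    inv_mul_cancel, U_one_apply]

theorem U_restrict_apply (Φ : StarRep (CrossedProduct α) H) (g : G) (a : A) (ξ : H) :
    Φ (CrossedProduct.U α g) (Φ.restrict a ξ) =
      Φ.restrict (α g a) (Φ (CrossedProduct.U α g) ξ) := by
  change Φ (CrossedProduct.U α g) (Φ (CrossedProduct.ι α a) ξ) =
      Φ (CrossedProduct.ι α (α g a)) (Φ (CrossedProduct.U α g) ξ)
  rw [← CrossedProduct.covariant, map_mul, map_mul, mul_apply_eq_comp,
    mul_apply_eq_comp, U_mul_apply, inv_mul_cancel, U_one_apply]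

theorem apply_eq_sum (Φ : StarRep (CrossedProduct α) H) (b : CrossedProduct α) (ξ : H) :
    Φ b ξ = ∑ g, Φ.restrict ((b : CStarMatrix G G A) 1 g) (Φ (CrossedProduct.U α g) ξ) := by
  conv_lhs => rw [CrossedProduct.eq_sum α b, map_sum]
  simp [restrict]

/-- A subspace is invariant under the crossed product if it is invariant under `A` and the
canonical unitaries. -/
theorem invariant_of_restrict (Φ : StarRep (CrossedProduct α) H) {S : Submodule ℂ H}
    (hA : ∀ a, ∀ ξ ∈ S, Φ.restrict a ξ ∈ S) (hU : ∀ g, ∀ ξ ∈ S, Φ (CrossedProduct.U α g) ξ ∈ S)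
    (b : CrossedProduct α) : ∀ ξ ∈ S, Φ b ξ ∈ S := fun ξ hξ => by
  rw [apply_eq_sum]
  exact Submodule.sum_mem _ fun g _ => hA _ _ (hU g ξ hξ)

theorem mem_intertwiners_of_restrict {T : H →L[ℂ] K}
    (hA : T ∈ intertwiners Φ.restrict Ψ.restrict)
    (hU : ∀ g ξ, T (Φ (CrossedProduct.U α g) ξ) = Ψ (CrossedProduct.U α g) (T ξ)) :
    T ∈ intertwiners Φ Ψ := fun b ξ => by
  rw [apply_eq_sum, apply_eq_sum, map_sum]
  exact Finset.sum_congr rfl fun g _ => by rw [hA, hU]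

variable {H₁ : Type v} [NormedAddCommGroup H₁] [InnerProductSpace ℂ H₁] [CompleteSpace H₁]
  {π : StarRep A H₁}

/-- The isometry `J` followed by the unitary of `g`. -/
def translate (Φ : StarRep (CrossedProduct α) H) (g : G) (J : H₁ →ₗᵢ[ℂ] H) : H₁ →ₗᵢ[ℂ] H :=
  ⟨(Φ (CrossedProduct.U α g) ∘L J.toContinuousLinearMap : H₁ →L[ℂ] H), fun ξ => by
    simp [norm_U_apply]⟩

theorem translate_apply (Φ : StarRep (CrossedProduct α) H) (g : G) (J : H₁ →ₗᵢ[ℂ] H) (ξ : H₁) :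
    Φ.translate g J ξ = Φ (CrossedProduct.U α g) (J ξ) := rfl

variable {J : H₁ →ₗᵢ[ℂ] H}

/-- The inverse is forced by covariance: `U_g⁻¹ b = α_g⁻¹(b) U_g⁻¹`, so `b = α_g(a)` is carried back
to `a`. -/
theorem translate_mem_intertwiners (hJ : J.toContinuousLinearMap ∈ intertwiners π Φ.restrict)
    (g : G) : (Φ.translate g⁻¹ J).toContinuousLinearMap ∈
      intertwiners (π.twist α g) Φ.restrict := fun a ξ => by
  have h : J (π (α g a) ξ) = Φ.restrict (α g a) (J ξ) := hJ _ ξ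
  change Φ (CrossedProduct.U α g⁻¹) (J (π (α g a) ξ)) =
    Φ.restrict a (Φ (CrossedProduct.U α g⁻¹) (J ξ))
  rw [h, U_restrict_apply]
  simp [← StarAlgEquiv.mul_apply]

/-- Inequivalent twists occupy orthogonal subspaces. -/
theorem inner_translate_eq_zero (hπ : π.IsIrreducible)
    (hJ : J.toContinuousLinearMap ∈ intertwiners π Φ.restrict) {g h : G}
    (hgh : ¬ π.UnitarilyEquiv (π.twist α (h * g⁻¹))) (ξ ζ : H₁) :
    inner ℂ (Φ.translate g⁻¹ J ξ) (Φ.translate h⁻¹ J ζ) = 0 := by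
  -- The overlap of the two ranges is an intertwiner between the two twists, so Schur's lemma kills
  -- it.
  set T := ContinuousLinearMap.adjoint (Φ.translate g⁻¹ J).toContinuousLinearMap ∘L
    (Φ.translate h⁻¹ J).toContinuousLinearMap with hTdef
  have hT : T ∈ intertwiners (π.twist α h) (π.twist α g) :=
    comp_mem_intertwiners (adjoint_mem_intertwiners (translate_mem_intertwiners hJ g))
      (translate_mem_intertwiners hJ h)
  have h0 : T = 0 := by
    by_contra h0
    exact hgh ((hπ.twist α h).unitarilyEquiv (hπ.twist α g) hT h0).symm.twist_mul_inv
  have : inner ℂ ξ (T ζ) = 0 := by simp [h0]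
  rwa [hTdef, ContinuousLinearMap.comp_apply, ContinuousLinearMap.adjoint_inner_right] at this

end Translate

/-! ### Irreducible subrepresentations of the restriction -/

section Existence

variable {A : Type u} [CStarAlgebra A] {G : Type w} [Group G] [Fintype G] [DecidableEq G]
  {α : G →* (A ≃⋆ₐ[ℂ] A)}
  {H : Type v} [NormedAddCommGroup H] [InnerProductSpace ℂ H] [CompleteSpace H]
  {Φ : StarRep (CrossedProduct α) H}

theorem starProjection_mem_intertwiners {B : Type*} [Semiring B] [StarRing B] [Algebra ℂ B]
    {ρ : StarRep B H} (S : Submodule ℂ H) [S.HasOrthogonalProjection]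
    (hS : ∀ b, ∀ ξ ∈ S, ρ b ξ ∈ S) : S.starProjection ∈ intertwiners ρ ρ := fun b ξ => by
  refine Submodule.eq_starProjection_of_mem_of_inner_eq_zero
    (hS b _ (Submodule.starProjection_apply_mem _ _)) fun ζ hζ => ?_
  rw [← map_sub, ← ContinuousLinearMap.adjoint_inner_right, ← ContinuousLinearMap.star_eq_adjoint,
    ← map_star]
  exact Submodule.starProjection_inner_eq_zero _ _ (hS _ _ hζ)

/-- The average `Q` of the conjugates of the projection commutes with `A` and with every `U_g`, so
it is a scalar. The constant `c` measures the size of `S` and drives the descent to a minimal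
subspace. -/
theorem exists_sum_norm_sq_starProjection (hΦ : Φ.IsIrreducible) (S : Submodule ℂ H)
    [S.HasOrthogonalProjection] (hS : ∀ a, ∀ ξ ∈ S, Φ.restrict a ξ ∈ S) :
    ∃ c : ℝ, ∀ ξ, ∑ g, ‖S.starProjection (Φ (CrossedProduct.U α g) ξ)‖ ^ 2 = c * ‖ξ‖ ^ 2 := by
  set P := S.starProjection
  have hP : P ∈ intertwiners Φ.restrict Φ.restrict := starProjection_mem_intertwiners S hS
  set Q : H →L[ℂ] H := ∑ g, Φ (CrossedProduct.U α g⁻¹) ∘L P ∘L Φ (CrossedProduct.U α g)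
  have hQ : ∀ ξ, Q ξ = ∑ g, Φ (CrossedProduct.U α g⁻¹) (P (Φ (CrossedProduct.U α g) ξ)) :=
    fun ξ => by simp [Q]
  have hin : ∀ ξ ζ, inner ℂ (Q ξ) ζ =
      ∑ g, inner ℂ (P (Φ (CrossedProduct.U α g) ξ)) (P (Φ (CrossedProduct.U α g) ζ)) := by
    intro ξ ζ
    rw [hQ, sum_inner]
    refine Finset.sum_congr rfl fun g _ => ?_
    rw [U_inner_left, inv_inv, ← Submodule.inner_starProjection_left_eq_right,
      Submodule.starProjection_eq_self_iff.2 (Submodule.starProjection_apply_mem _ _)]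
  have hQΦ : Q ∈ intertwiners Φ Φ := by
    refine mem_intertwiners_of_restrict (fun a ξ => ?_) fun h ξ => ?_
    · rw [hQ, hQ, map_sum]
      refine Finset.sum_congr rfl fun g _ => ?_
      rw [U_restrict_apply, hP, U_restrict_apply, ← StarAlgEquiv.mul_apply, ← map_mul]
      simp
    · rw [hQ, hQ, map_sum]
      refine Fintype.sum_equiv (Equiv.mulRight h) _ _ fun g => ?_
      simp [U_mul_apply]
  obtain ⟨c, hc⟩ := hΦ.exists_eq_smul_of_isSelfAdjoint hQΦ (by
    rw [ContinuousLinearMap.isSelfAdjoint_iff_isSymmetric]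
    intro ξ ζ
    change inner ℂ (Q ξ) ζ = inner ℂ ξ (Q ζ)
    rw [← inner_conj_symm ξ, hin, hin, map_sum]
    simp)
  refine ⟨c, fun ξ => ?_⟩
  have h1 := hin ξ ξ
  rw [hc] at h1
  simp only [smul_apply, one_apply_eq_self, inner_smul_left, inner_self_eq_norm_sq_to_K,
    Complex.conj_ofReal] at h1
  have h2 : (c : ℂ) * (‖ξ‖ : ℂ) ^ 2 =
    ∑ g, (‖P (Φ (CrossedProduct.U α g) ξ)‖ : ℂ) ^ 2 := h1
  exact_mod_cast h2.symm

/-- Without a minimal subspace one could descend forever, yet each strict inclusion lowers the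
nonnegative constant of the averaged projection by at least 1. -/
theorem exists_minimal_invariant_subspace (hΦ : Φ.IsIrreducible) :
    ∃ S : Submodule ℂ H, IsClosed (S : Set H) ∧ (∀ a, ∀ ξ ∈ S, Φ.restrict a ξ ∈ S) ∧ S ≠ ⊥ ∧
      ∀ T : Submodule ℂ H, IsClosed (T : Set H) → (∀ a, ∀ ξ ∈ T, Φ.restrict a ξ ∈ T) → T ≤ S →
        T ≠ ⊥ → T = S := by
  by_contra! hno
  have key : ∀ n : ℕ, ∀ S : Submodule ℂ H, IsClosed (S : Set H) →
      (∀ a, ∀ ξ ∈ S, Φ.restrict a ξ ∈ S) → S ≠ ⊥ → ∀ [S.HasOrthogonalProjection],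
      ∀ c : ℝ, (∀ ξ, ∑ g, ‖S.starProjection (Φ (CrossedProduct.U α g) ξ)‖ ^ 2 = c * ‖ξ‖ ^ 2) →
        ¬ c < n := by
    intro n
    induction n with
    | zero =>
      intro S _ _ hS0 _ c hc hcn
      obtain ⟨ξ, -, hξ⟩ := (Submodule.ne_bot_iff S).1 hS0
      have h1 : 0 ≤ c * ‖ξ‖ ^ 2 := by
        rw [← hc]
        positivity
      have h2 : 0 < ‖ξ‖ ^ 2 := by positivity
      push_cast at hcn
      nlinarith
    | succ n ih =>
      intro S hS hSA hS0 _ c hc hcn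
      obtain ⟨T, hT, hTA, hTS, hT0, hne⟩ := hno S hS hSA hS0
      have : CompleteSpace T := hT.completeSpace_coe
      obtain ⟨d, hd⟩ := exists_sum_norm_sq_starProjection hΦ T hTA
      refine ih T hT hTA hT0 d hd ?_
      obtain ⟨x, hxS, hxT⟩ := SetLike.exists_of_lt (lt_of_le_of_ne hTS hne)
      -- A nonzero vector of `S` orthogonal to `T`: the term `g = 1` contributes `‖ξ‖²` to the sum
      -- for `S` and nothing to that for `T`, whence `d + 1 ≤ c`.
      set ξ := x - T.starProjection x
      have hTx := Submodule.starProjection_apply_mem T x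
      have hξ0 : ξ ≠ 0 := fun h => hxT (by rwa [sub_eq_zero.1 h])
      have hξS : S.starProjection ξ = ξ :=
        Submodule.starProjection_eq_self_iff.2 (S.sub_mem hxS (hTS hTx))
      have hξT : T.starProjection ξ = 0 := by
        rw [map_sub, Submodule.starProjection_eq_self_iff.2 hTx, sub_self]
      have hle : ∀ ζ, ‖T.starProjection ζ‖ ≤ ‖S.starProjection ζ‖ := fun ζ => by
        have : T.starProjection ζ = T.starProjection (S.starProjection ζ) := by
          refine Submodule.eq_starProjection_of_mem_of_inner_eq_zero
            (Submodule.starProjection_apply_mem _ _) fun η hη => ?_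
          rw [← sub_add_sub_cancel ζ (S.starProjection ζ), inner_add_left,
            Submodule.starProjection_inner_eq_zero _ _ (hTS hη),
            Submodule.starProjection_inner_eq_zero _ _ hη, zero_add]
        rw [this]
        exact Submodule.norm_starProjection_apply_le _ _
      have hsum : d * ‖ξ‖ ^ 2 + ‖ξ‖ ^ 2 ≤ c * ‖ξ‖ ^ 2 := by
        rw [← hd, ← hc, ← Finset.sum_erase_add _ _ (Finset.mem_univ (1 : G)),
          ← Finset.sum_erase_add _ _ (Finset.mem_univ (1 : G)), U_one_apply, hξS, hξT, norm_zero,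
          zero_pow two_ne_zero, add_zero]
        have : ∀ g, ‖T.starProjection (Φ (CrossedProduct.U α g) ξ)‖ ^ 2 ≤
            ‖S.starProjection (Φ (CrossedProduct.U α g) ξ)‖ ^ 2 := fun g =>
          pow_le_pow_left₀ (norm_nonneg _) (hle _) 2
        exact add_le_add_left (Finset.sum_le_sum fun g _ => this g) _
      have h2 : 0 < ‖ξ‖ ^ 2 := by positivity
      have : d + 1 ≤ c := le_of_mul_le_mul_right (by linarith) h2
      push_cast at hcn
      linarith
  have := hΦ.1
  obtain ⟨c, hc⟩ := exists_sum_norm_sq_starProjection hΦ ⊤ fun _ _ _ => trivial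
  obtain ⟨n, hn⟩ := exists_nat_gt c
  exact key n ⊤ isClosed_univ (fun _ _ _ => trivial) top_ne_bot c hc hn

/-- The restriction to `A` of an irreducible representation of `A ⋊ G` contains an irreducible
representation. -/
theorem IsIrreducible.exists_irreducible_restrict (hΦ : Φ.IsIrreducible) :
    ∃ (H₁ : Type v) (_ : NormedAddCommGroup H₁) (_ : InnerProductSpace ℂ H₁)
      (_ : CompleteSpace H₁) (π : StarRep A H₁) (J : H₁ →ₗᵢ[ℂ] H), π.IsIrreducible ∧
      J.toContinuousLinearMap ∈ intertwiners π Φ.restrict := by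
  obtain ⟨S, hS, hSA, hS0, hmin⟩ := exists_minimal_invariant_subspace hΦ
  have : CompleteSpace S := hS.completeSpace_coe
  refine ⟨S, inferInstance, inferInstance, inferInstance,
    compress Φ.restrict S.subtypeₗᵢ fun a ξ => ⟨⟨_, hSA a ξ ξ.2⟩, rfl⟩, S.subtypeₗᵢ,
    isIrreducible_compress_subtype _ S _ hS0 hmin, fun a ξ => ?_⟩
  exact compress_apply _ S.subtypeₗᵢ _ a ξ

end Existence

end StarRep

/-! ### Stabilizers of irreducible subrepresentations -/

namespace StarRep

section Stabilizer

variable {A : Type u} [CStarAlgebra A] {G : Type w} [Group G] [Fintype G] [DecidableEq G]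
  {α : G →* (A ≃⋆ₐ[ℂ] A)}
  {H : Type v} [NormedAddCommGroup H] [InnerProductSpace ℂ H] [CompleteSpace H]
  {Φ : StarRep (CrossedProduct α) H}
  {H₁ : Type v} [NormedAddCommGroup H₁] [InnerProductSpace ℂ H₁] [CompleteSpace H₁]
  {π : StarRep A H₁} {J : H₁ →ₗᵢ[ℂ] H}

/-- The elements of the group whose unitaries leave the range of `J` invariant. -/
def rangeStabilizer (Φ : StarRep (CrossedProduct α) H) (J : H₁ →ₗᵢ[ℂ] H) : Submonoid G where
  carrier := {g | ∀ ξ, ∃ ζ, Φ (CrossedProduct.U α g) (J ξ) = J ζ}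
  one_mem' ξ := ⟨ξ, U_one_apply Φ _⟩
  mul_mem' {g h} hg hh ξ := by
    obtain ⟨ζ, hζ⟩ := hh ξ
    obtain ⟨ζ', hζ'⟩ := hg ζ
    exact ⟨ζ', by rw [← U_mul_apply, hζ, hζ']⟩

theorem zpowers_subset_rangeStabilizer {g : G} (hg : g ∈ Φ.rangeStabilizer J) {h : G}
    (hh : h ∈ Subgroup.zpowers g) : h ∈ Φ.rangeStabilizer J :=
  Submonoid.powers_le.2 hg (mem_powers_iff_mem_zpowers.2 hh)

/-- If the range of `J` is invariant under a subgroup, then the representation it carries is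
minimal for that subgroup. -/
theorem isMinimalFor_of_le_rangeStabilizer (hπ : π.IsIrreducible)
    (hJ : J.toContinuousLinearMap ∈ intertwiners π Φ.restrict) (N : Subgroup G) [Fintype N]
    [DecidableEq N] (hN : ∀ h ∈ N, h ∈ Φ.rangeStabilizer J) :
    IsMinimalFor (α.comp N.subtype) π := by
  let V : N →* unitary (H →L[ℂ] H) :=
    { toFun := fun h => ⟨Φ (CrossedProduct.U α h), by
        rw [Unitary.mem_iff, ← map_star, CrossedProduct.star_U, ← map_mul, ← map_mul,
          ← CrossedProduct.U_mul, ← CrossedProduct.U_mul]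
        simp [CrossedProduct.U_one]⟩
      map_one' := by
        ext1
        simp [CrossedProduct.U_one]
      map_mul' := fun g h => by
        ext1
        simp [CrossedProduct.U_mul] }
  -- The universal property yields the restriction of `Φ` to the crossed product by `N`; it is then
  -- cut down to the range of `J`. The result is irreducible because its restriction to `A` already
  -- is.
  obtain ⟨Ψ₀, ⟨hΨ, hΨU⟩, -⟩ := CrossedProduct.existsUnique_lift (α.comp N.subtype) Φ.restrict V
    fun h a => by
      ext ξ
      change Φ (CrossedProduct.U α h) (Φ.restrict a (Φ (CrossedProduct.U α (h⁻¹ : N)) ξ)) =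
        Φ.restrict (α h a) ξ
      rw [U_restrict_apply, U_mul_apply]
      simp [U_one_apply]
  have hinv : ∀ b ξ, ∃ ζ, Ψ₀ b (J ξ) = J ζ := fun b ξ => by
    have := invariant_of_restrict Ψ₀ (S := LinearMap.range J.toLinearMap) (by
        rintro a _ ⟨ξ, rfl⟩
        refine ⟨π a ξ, ?_⟩
        change J (π a ξ) = Ψ₀ (CrossedProduct.ι _ a) (J ξ)
        rw [hΨ]
        exact hJ a ξ) (by
        rintro h _ ⟨ξ, rfl⟩
        obtain ⟨ζ, hζ⟩ := hN h h.2 ξ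
        refine ⟨ζ, ?_⟩
        change J ζ = Ψ₀ (CrossedProduct.U _ h) (J ξ)
        rw [hΨU, ← hζ]
        rfl) b (J ξ) ⟨ξ, rfl⟩
    obtain ⟨ζ, hζ⟩ := this
    exact ⟨ζ, hζ.symm⟩
  have hres : restrict (compress Ψ₀ J hinv) = π := by
    ext a ξ
    apply J.injective
    exact (compress_apply Ψ₀ J hinv _ ξ).trans (congr($(hΨ a) (J ξ)).trans (hJ a ξ).symm)
  refine ⟨hπ, compress Ψ₀ J hinv, ⟨hπ.1, fun S hS hS' => hπ.2 S hS fun a ξ hξ => ?_⟩, hres⟩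
  rw [← hres]
  exact hS' _ ξ hξ

/-- A linear endomorphism with a power acting by a scalar on a nonzero vector has an eigenvector
in every invariant subspace containing that vector. -/
theorem _root_.Module.End.exists_eigenvector_of_pow {E : Type*} [AddCommGroup E] [Module ℂ E]
    (φ : Module.End ℂ E) {v : E} (hv : v ≠ 0) {n : ℕ} (hn : 0 < n) {c : ℂ}
    (h : (φ ^ n) v = c • v) (M : Submodule ℂ E) (hM : ∀ x ∈ M, φ x ∈ M) (hvM : v ∈ M) :
    ∃ w ∈ M, w ≠ 0 ∧ ∃ μ : ℂ, φ w = μ • w := by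
  -- The cyclic span of `v` is finite-dimensional and `φ`-invariant, since `φ ^ n` returns `v` to
  -- its own line; an eigenvector exists there even though `E` may be infinite-dimensional.
  set F : Submodule ℂ E := Submodule.span ℂ (Set.range fun j : Fin n => (φ ^ (j : ℕ)) v)
  have hvF : v ∈ F := Submodule.subset_span ⟨⟨0, hn⟩, by simp⟩
  have hFM : F ≤ M := by
    refine Submodule.span_le.2 ?_
    rintro _ ⟨⟨j, hj⟩, rfl⟩
    change (φ ^ j) v ∈ M
    clear hj
    induction j with
    | zero => simpa
    | succ j ih =>
      rw [pow_succ']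
      exact hM _ ih
  have hF : ∀ x ∈ F, φ x ∈ F := by
    intro x hx
    induction hx using Submodule.span_induction with
    | zero => simp
    | add x y _ _ hx hy => simpa using F.add_mem hx hy
    | smul a x _ hx => simpa using F.smul_mem a hx
    | mem x hx =>
      obtain ⟨⟨j, hj⟩, rfl⟩ := hx
      have hs : φ ((φ ^ j) v) = (φ ^ (j + 1)) v := by
        rw [pow_succ']
        rfl
      simp only [hs]
      rcases (Nat.succ_le_of_lt hj).lt_or_eq with h' | h'
      · exact Submodule.subset_span ⟨⟨j + 1, h'⟩, rfl⟩
      · rw [show j + 1 = n from h', h]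
        exact F.smul_mem _ hvF
  have : FiniteDimensional ℂ F := FiniteDimensional.span_of_finite ℂ (Set.finite_range _)
  have : Nontrivial F := ⟨⟨v, hvF⟩, 0, fun h => hv congr(($h : E))⟩
  obtain ⟨μ, hμ⟩ := Module.End.exists_eigenvalue (φ.restrict hF)
  obtain ⟨w, hw⟩ := hμ.exists_hasEigenvector
  exact ⟨w, hFM w.2, fun h => hw.2 (Subtype.ext h), μ, congr(($hw.apply_eq_smul : E))⟩

/-- If `π` is equivalent to its twist by `g`, then a copy of `π` can be chosen to be invariant
under the unitary of `g`. -/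
theorem exists_mem_rangeStabilizer (hπ : π.IsIrreducible)
    (hJ : J.toContinuousLinearMap ∈ intertwiners π Φ.restrict) {g : G}
    (hg : π.UnitarilyEquiv (π.twist α g)) :
    ∃ J' : H₁ →ₗᵢ[ℂ] H, J'.toContinuousLinearMap ∈ intertwiners π Φ.restrict ∧
      g ∈ Φ.rangeStabilizer J' := by
  have := hπ.1
  obtain ⟨W, hW⟩ := hg
  let W' : H₁ →L[ℂ] H₁ := W
  have hWn : ∀ n a ξ, (W' ^ n) (π a ξ) = π (α (g ^ n) a) ((W' ^ n) ξ) := by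
    intro n a
    induction n with
    | zero => simp
    | succ n ih =>
      intro ξ
      rw [pow_succ', mul_apply_eq_comp, ih, mul_apply_eq_comp, pow_succ']
      exact (hW _ _).trans (by simp [StarRep.twist, W'])
  -- The power `W ^ n` intertwines `π` with its twist by `g ^ n`; at the order of `g` the twist is
  -- trivial and Schur's lemma applies.
  obtain ⟨c, hc⟩ := hπ.exists_eq_smul (T := W' ^ orderOf g) fun a ξ => by
    simp [hWn, pow_orderOf_eq_one]
  -- This map preserves the intertwiners from `π` to `Φ|A`. An eigenvector `T` with nonzero
  -- eigenvalue satisfies `U_g T = μ⁻¹ T W`, so `U_g` preserves its range.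
  let φ : Module.End ℂ (H₁ →L[ℂ] H) :=
    { toFun := fun T => Φ (CrossedProduct.U α g⁻¹) ∘L T ∘L W'
      map_add' := fun S T => by
        ext ξ
        simp
      map_smul' := fun c T => by
        ext ξ
        simp }
  have hφ : ∀ T ξ, φ T ξ = Φ (CrossedProduct.U α g⁻¹) (T (W' ξ)) := fun _ _ => rfl
  have hφn : ∀ n T ξ, (φ ^ n) T ξ = Φ (CrossedProduct.U α (g ^ n)⁻¹) (T ((W' ^ n) ξ)) := by
    intro n T
    induction n with
    | zero => simp [U_one_apply]
    | succ n ih =>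
      intro ξ
      rw [pow_succ', Module.End.mul_apply, hφ, ih, U_mul_apply, pow_succ W', pow_succ g,
        mul_inv_rev]
      rfl
  have hJ0 : J.toContinuousLinearMap ≠ 0 := fun h => by
    obtain ⟨ξ, hξ⟩ := exists_ne (0 : H₁)
    exact hξ (J.injective (congr($h ξ).trans (map_zero J).symm))
  obtain ⟨T, hT, hT0, μ, hμ⟩ := φ.exists_eigenvector_of_pow hJ0 (orderOf_pos g) (c := c) (by
      ext ξ
      rw [hφn, hc, pow_orderOf_eq_one]
      simp [U_one_apply]) (intertwiners π Φ.restrict) (fun T hT a ξ => by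
      rw [hφ, hφ, show W' (π a ξ) = π (α g a) (W' ξ) from hW a ξ, hT, U_restrict_apply]
      simp [← StarAlgEquiv.mul_apply]) hJ
  obtain ⟨r, J', hr, hJ', hTJ'⟩ := hπ.exists_isometry hT hT0
  have hμ' : ∀ ξ, T (W' ξ) = μ • Φ (CrossedProduct.U α g) (T ξ) := fun ξ => by
    have := congr(Φ (CrossedProduct.U α g) ($hμ ξ))
    rw [hφ, U_mul_apply, mul_inv_cancel, U_one_apply] at this
    simpa using this
  have hμ0 : μ ≠ 0 := by
    rintro rfl
    refine hT0 (ContinuousLinearMap.ext fun ξ => ?_)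
    have := hμ' (W.symm ξ)
    rw [zero_smul] at this
    rwa [show W' (W.symm ξ) = ξ from W.apply_symm_apply ξ] at this
  have hr0 : (r : ℂ) ≠ 0 := by exact_mod_cast hr.ne'
  refine ⟨J', hJ', fun ξ => ⟨μ⁻¹ • W' ξ, ?_⟩⟩
  have h1 := hμ' ξ
  rw [hTJ', hTJ', map_smul, smul_comm] at h1
  rw [map_smul, smul_right_injective _ hr0 h1, smul_smul, inv_mul_cancel₀ hμ0, one_smul]

end Stabilizer

/-! ### Induced representations -/

section Induced

variable {A : Type u} [CStarAlgebra A] {G : Type w} [Group G] [Fintype G] [DecidableEq G]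
  {α : G →* (A ≃⋆ₐ[ℂ] A)}
  {H : Type v} [NormedAddCommGroup H] [InnerProductSpace ℂ H] [CompleteSpace H]
  {Φ : StarRep (CrossedProduct α) H}
  {H₁ : Type v} [NormedAddCommGroup H₁] [InnerProductSpace ℂ H₁] [CompleteSpace H₁]
  {π : StarRep A H₁} {J : H₁ →ₗᵢ[ℂ] H}

/-- If orthogonal translates of a copy of `π` are permuted by the group, then an irreducible
representation of the crossed product is their direct sum. -/
theorem IsIrreducible.exists_isDirectSum (hΦ : Φ.IsIrreducible) [Nontrivial H₁]
    (hJ : J.toContinuousLinearMap ∈ intertwiners π Φ.restrict) {n : ℕ} [NeZero n] (g : Fin n → G)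
    (horth : ∀ i j, i ≠ j → ∀ ξ ζ,
      inner ℂ (Φ.translate (g i)⁻¹ J ξ) (Φ.translate (g j)⁻¹ J ζ) = 0)
    (hstab : ∀ h i, ∃ j, g j * h * (g i)⁻¹ ∈ Φ.rangeStabilizer J) :
    ∃ Φ' : StarRep (CrossedProduct α) (PiLp 2 fun _ : Fin n => H₁),
      Φ.UnitarilyEquiv Φ' ∧ Φ'.restrict.IsDirectSum (fun i => π.twist α (g i)) ∧
      ∀ h (s : Equiv.Perm (Fin n)), (∀ i, g i * h = g (s i)) →
        ∀ ξ i, Φ' (CrossedProduct.U α h) ξ i = ξ (s i) := by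
  have hof : OrthogonalFamily ℂ (fun _ : Fin n => H₁) fun i => Φ.translate (g i)⁻¹ J :=
    fun i j hij => horth i j hij
  -- Orthogonality of the translates makes their sum an isometry. Its range is invariant, so
  -- irreducibility of `Φ` makes it unitary, and `Φ'` is `Φ` transported along it.
  let E : (PiLp 2 fun _ : Fin n => H₁) →ₗᵢ[ℂ] H :=
    { toFun := fun ξ => ∑ i, Φ.translate (g i)⁻¹ J (ξ i)
      map_add' := fun ξ ζ => by simp [Finset.sum_add_distrib]
      map_smul' := fun c ξ => by simp [Finset.smul_sum]
      norm_map' := fun ξ => by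
        rw [← sq_eq_sq₀ (norm_nonneg _) (norm_nonneg _), PiLp.norm_sq_eq_of_L2]
        exact hof.norm_sum (fun i => ξ i) Finset.univ }
  have hE : ∀ ξ, E ξ = ∑ i, Φ.translate (g i)⁻¹ J (ξ i) := fun _ => rfl
  have hEA : ∀ a ξ, Φ.restrict a (E ξ) =
      E (WithLp.toLp 2 fun i => π.twist α (g i) a (ξ i)) := fun a ξ => by
    rw [hE, hE, map_sum]
    exact Finset.sum_congr rfl fun i _ => (translate_mem_intertwiners hJ (g i) a (ξ i)).symm
  have hsingle : ∀ i ζ, Φ.translate (g i)⁻¹ J ζ ∈ LinearMap.range E.toLinearMap := fun i ζ => by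
    refine ⟨WithLp.toLp 2 (Pi.single i ζ), ?_⟩
    change E _ = _
    rw [hE, Finset.sum_eq_single i]
    · simp
    · intro j _ hj
      simp [hj]
    · simp
  have hinv : ∀ b ξ, ∃ ζ, Φ b (E ξ) = E ζ := fun b ξ => by
    have := invariant_of_restrict Φ (S := LinearMap.range E.toLinearMap) (by
        rintro a _ ⟨ξ, rfl⟩
        exact ⟨_, (hEA a ξ).symm⟩) (by
        rintro h _ ⟨ξ, rfl⟩
        change Φ _ (E ξ) ∈ _
        rw [hE, map_sum]
        refine Submodule.sum_mem _ fun i _ => ?_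
        obtain ⟨j, hj⟩ := hstab h i
        obtain ⟨ζ, hζ⟩ := hj (ξ i)
        -- Uses `h g_i⁻¹ = g_j⁻¹ (g_j h g_i⁻¹)`, where the bracket preserves the range of `J`.
        have : Φ (CrossedProduct.U α h) (Φ.translate (g i)⁻¹ J (ξ i)) =
            Φ.translate (g j)⁻¹ J ζ := by
          rw [translate_apply, translate_apply, ← hζ, U_mul_apply, U_mul_apply]
          congr 3
          group
        rw [this]
        exact hsingle j ζ) b (E ξ) ⟨ξ, rfl⟩
    obtain ⟨ζ, hζ⟩ := this
    exact ⟨ζ, hζ.symm⟩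
  have : Nontrivial (PiLp 2 fun _ : Fin n => H₁) := by
    obtain ⟨ξ, hξ⟩ := exists_ne (0 : H₁)
    exact ⟨WithLp.toLp 2 fun _ => ξ, 0, fun h => hξ congr(($h) 0)⟩
  obtain ⟨W, hW⟩ := hΦ.exists_equiv E hinv
  have hcomp := compress_apply Φ E hinv
  refine ⟨Φ.compress E hinv, UnitarilyEquiv.symm ⟨W, fun b ξ => ?_⟩, fun a ξ i => ?_,
    fun h s hs ξ i => ?_⟩
  · rw [hW, hW, hcomp]
  · have : (Φ.compress E hinv).restrict a ξ =
        WithLp.toLp 2 fun i => π.twist α (g i) a (ξ i) :=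
      E.injective ((hcomp _ ξ).trans (hEA a ξ))
    rw [this]
  · have : Φ.compress E hinv (CrossedProduct.U α h) ξ = WithLp.toLp 2 fun i => ξ (s i) := by
      apply E.injective
      rw [hcomp, hE, hE, map_sum]
      refine (Fintype.sum_equiv s _ _ fun i => ?_).symm
      rw [translate_apply, translate_apply, U_mul_apply, ← hs]
      congr 3
      group
    rw [this]

end Induced

end StarRep

/-! ### Existence of the type -/

theorem closure_τ_η : Subgroup.closure {τ, η} = (⊤ : Subgroup S3) := by
  rw [eq_top_iff]
  intro g _
  have hτ : τ ∈ Subgroup.closure {τ, η} := Subgroup.subset_closure (by simp)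
  have hη : η ∈ Subgroup.closure {τ, η} := Subgroup.subset_closure (by simp)
  have h : ∀ g : S3, g = 1 ∨ g = η ∨ g = η * η ∨ g = τ ∨ g = η * τ ∨ g = η * η * τ := by decide
  rcases h g with rfl | rfl | rfl | rfl | rfl | rfl
  · exact one_mem _
  · exact hη
  · exact mul_mem hη hη
  · exact hτ
  · exact mul_mem hη hτ
  · exact mul_mem (mul_mem hη hη) hτ

namespace StarRep

section

variable {A : Type u} [CStarAlgebra A] {α : S3 →* (A ≃⋆ₐ[ℂ] A)}
  {H : Type v} [NormedAddCommGroup H] [InnerProductSpace ℂ H] [CompleteSpace H]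
  {Φ : StarRep (CrossedProduct α) H}
  {H₁ : Type v} [NormedAddCommGroup H₁] [InnerProductSpace ℂ H₁] [CompleteSpace H₁]
  {π : StarRep A H₁} {J : H₁ →ₗᵢ[ℂ] H}

theorem not_unitarilyEquiv_twist_η_sq (h : ¬ π.UnitarilyEquiv (π.twist α η)) :
    ¬ π.UnitarilyEquiv (π.twist α (η ^ 2)) := fun e => by
  have e' : (π.twist α (η ^ 2)).UnitarilyEquiv (π.twist α 1) := by
    rw [twist_one]
    exact e.symm
  have := e'.twist_mul_inv
  rw [show (1 : S3) * (η ^ 2)⁻¹ = η by decide] at this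
  exact h this

theorem isTypeSixFrom (hΦ : Φ.IsIrreducible) (hπ : π.IsIrreducible)
    (hJ : J.toContinuousLinearMap ∈ intertwiners π Φ.restrict)
    (h : ∀ σ : S3, σ ≠ 1 → ¬ π.UnitarilyEquiv (π.twist α σ)) : IsTypeSixFrom Φ π := by
  have := hπ.1
  let g : Fin 6 → S3 := ![1, η, η ^ 2, τ, η * τ, η ^ 2 * τ]
  have hg1 : ∀ i j, i ≠ j → g j * (g i)⁻¹ ≠ 1 := by decide
  have hg2 : ∀ h i, ∃ j, g j * h * (g i)⁻¹ = 1 := by decide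
  obtain ⟨Φ', hΦ', hsum, hU⟩ := hΦ.exists_isDirectSum hJ g
    (fun i j hij => inner_translate_eq_zero hπ hJ (h _ (hg1 i j hij)))
    (fun h i => (hg2 h i).imp fun j hj => by
      rw [hj]
      exact one_mem _)
  have hgt : (fun i => π.twist α (g i)) = ![π, π.twist α η, π.twist α (η ^ 2),
      π.twist α τ, π.twist α (η * τ), π.twist α (η ^ 2 * τ)] := by
    funext i
    fin_cases i <;> simp [g, twist_one]
  -- Right multiplication by `η` on the list `g`; `t` below does the same for `τ`.
  let s : Equiv.Perm (Fin 6) := ⟨![1, 2, 0, 5, 3, 4], ![2, 0, 1, 4, 5, 3], by decide, by decide⟩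
  let t : Equiv.Perm (Fin 6) := ⟨![3, 4, 5, 0, 1, 2], ![3, 4, 5, 0, 1, 2], by decide, by decide⟩
  refine ⟨hπ, h, Φ', hΦ', hgt ▸ hsum, fun ξ i => ?_, fun ξ i => ?_⟩
  · rw [hU η s (by decide)]
    fin_cases i <;> simp [s, Fin.sum_univ_succ]
  · rw [hU τ t (by decide)]
    fin_cases i <;> simp [t, Fin.sum_univ_succ]

/-- The element `σ` is a transposition, so the powers of `η` represent the cosets of `{1, σ}` and
three translates suffice. -/
theorem isTypeThreeFrom (hΦ : Φ.IsIrreducible) (hπ : π.IsIrreducible)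
    (hJ : J.toContinuousLinearMap ∈ intertwiners π Φ.restrict)
    (hη : ¬ π.UnitarilyEquiv (π.twist α η)) {σ : S3} (hσ : σ ≠ 1 ∧ σ ≠ η ∧ σ ≠ η ^ 2)
    (hσJ : σ ∈ Φ.rangeStabilizer J) : IsTypeThreeFrom Φ π := by
  have := hπ.1
  have hη2 := not_unitarilyEquiv_twist_η_sq hη
  let g : Fin 3 → S3 := ![1, η, η ^ 2]
  have hg1 : ∀ i j, i ≠ j → g j * (g i)⁻¹ = η ∨ g j * (g i)⁻¹ = η ^ 2 := by decide
  have hg2 : ∀ σ : S3, σ ≠ 1 ∧ σ ≠ η ∧ σ ≠ η ^ 2 →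
      ∀ h i, ∃ j, g j * h * (g i)⁻¹ = 1 ∨ g j * h * (g i)⁻¹ = σ := by decide
  obtain ⟨Φ', hΦ', hsum, hU⟩ := hΦ.exists_isDirectSum hJ g
    (fun i j hij => inner_translate_eq_zero hπ hJ (by
      rcases hg1 i j hij with h | h <;> rwa [h]))
    (fun h i => (hg2 σ hσ h i).imp fun j hj => by
      rcases hj with hj | hj <;> rw [hj]
      exacts [one_mem _, hσJ])
  have hgt : (fun i => π.twist α (g i)) = ![π, π.twist α η, π.twist α (η ^ 2)] := by
    funext i
    fin_cases i <;> simp [g, twist_one]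
  let s : Equiv.Perm (Fin 3) := ⟨![1, 2, 0], ![2, 0, 1], by decide, by decide⟩
  refine ⟨hπ, hη, hη2, Φ', hΦ', hgt ▸ hsum, fun ξ i => ?_⟩
  rw [hU η s (by decide)]
  fin_cases i <;> simp [s, Fin.sum_univ_succ]

/-- The cyclic group generated by `η` has cosets represented by `1` and `τ`. Being normal, it
preserves the translate by `τ` as well, which makes both summands minimal for `η`. -/
theorem isTypeTwoFrom (hΦ : Φ.IsIrreducible) (hπ : π.IsIrreducible)
    (hJ : J.toContinuousLinearMap ∈ intertwiners π Φ.restrict) (hη : η ∈ Φ.rangeStabilizer J)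
    (horth : ∀ ξ ζ, inner ℂ (J ξ) (Φ (CrossedProduct.U α τ) (J ζ)) = 0) :
    IsTypeTwoFrom Φ π := by
  have := hπ.1
  let g : Fin 2 → S3 := ![1, τ]
  have hτi : τ⁻¹ = τ := by decide
  have hg : ∀ h i, ∃ j, g j * h * (g i)⁻¹ = 1 ∨ g j * h * (g i)⁻¹ = η ∨
      g j * h * (g i)⁻¹ = η ^ 2 := by decide
  obtain ⟨Φ', hΦ', hsum, hU⟩ := hΦ.exists_isDirectSum hJ g
    (fun i j hij ξ ζ => by
      fin_cases i <;> fin_cases j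
      · exact absurd rfl hij
      · simpa [g, translate_apply, hτi, U_one_apply] using horth ξ ζ
      · rw [inner_eq_zero_symm]
        simpa [g, translate_apply, hτi, U_one_apply] using horth ζ ξ
      · exact absurd rfl hij)
    (fun h i => (hg h i).imp fun j hj => by
      rcases hj with hj | hj | hj <;> rw [hj]
      exacts [one_mem _, hη, pow_mem hη 2])
  have hgt : (fun i => π.twist α (g i)) = ![π, π.twist α τ] := by
    funext i
    fin_cases i <;> simp [g, twist_one]
  refine ⟨hπ, ⟨Φ', hΦ', hgt ▸ hsum, fun ξ i => ?_⟩,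
    isMinimalFor_of_le_rangeStabilizer hπ hJ _ fun h => zpowers_subset_rangeStabilizer hη,
    isMinimalFor_of_le_rangeStabilizer (hπ.twist α τ) (translate_mem_intertwiners hJ τ) _
      fun h => zpowers_subset_rangeStabilizer fun ξ => ?_⟩
  · rw [hU τ (Equiv.swap 0 1) (by decide)]
    fin_cases i <;> simp [Fin.sum_univ_succ]
  · obtain ⟨ζ, hζ⟩ := pow_mem hη 2 ξ
    refine ⟨ζ, ?_⟩
    rw [translate_apply, translate_apply, ← hζ, U_mul_apply, U_mul_apply,
      show η * τ⁻¹ = τ⁻¹ * η ^ 2 by decide]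

/-- The compression `T = J* U_τ J` is self-adjoint and nonzero, and `T²` is a scalar `c > 0`. With
`s = √c`, one of the embeddings `s J ± U_τ J T` is nonzero and has range invariant under `U_τ` and
`U_η`, so that range is all of `H`. -/
theorem isMinimal_of_inner_ne_zero (hΦ : Φ.IsIrreducible) (hπ : π.IsIrreducible)
    (hJ : J.toContinuousLinearMap ∈ intertwiners π Φ.restrict) (hη : η ∈ Φ.rangeStabilizer J)
    {ξ₀ ζ₀ : H₁} (h0 : inner ℂ (J ξ₀) (Φ (CrossedProduct.U α τ) (J ζ₀)) ≠ 0) : IsMinimal Φ := by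
  have := hπ.1
  have hτi : τ⁻¹ = τ := by decide
  have hττ : τ * τ = 1 := by decide
  set J' := ContinuousLinearMap.adjoint J.toContinuousLinearMap with hJ'def
  have hJ' : ∀ ξ x, inner ℂ ξ (J' x) = inner ℂ (J ξ) x := fun ξ x =>
    ContinuousLinearMap.adjoint_inner_right _ _ _
  have hJ'J : ∀ ξ, J' (J ξ) = ξ := fun ξ => ext_inner_left ℂ fun ζ => by
    rw [hJ', J.inner_map_map]
  have hηi : η⁻¹ ∈ Φ.rangeStabilizer J :=
    zpowers_subset_rangeStabilizer hη (inv_mem (Subgroup.mem_zpowers η))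
  -- The range projection `J J*` commutes with `U_η⁻¹`, as `U_η` and its inverse both preserve the
  -- range.
  have hP : ∀ x, J (J' (Φ (CrossedProduct.U α η⁻¹) x)) =
      Φ (CrossedProduct.U α η⁻¹) (J (J' x)) := fun x => by
    have h1 : J' (Φ (CrossedProduct.U α η⁻¹) x) =
        J' (Φ (CrossedProduct.U α η⁻¹) (J (J' x))) := by
      refine ext_inner_left ℂ fun ζ => ?_
      obtain ⟨ζ', hζ'⟩ := hη ζ
      rw [hJ', hJ', ← U_inner_left, ← U_inner_left, hζ', ← hJ', J.inner_map_map]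
    obtain ⟨ζ, hζ⟩ := hηi (J' x)
    rw [h1, hζ, hJ'J]
  set T := J' ∘L (Φ.translate τ⁻¹ J).toContinuousLinearMap with hTdef
  have hTξ : ∀ ξ, T ξ = J' (Φ (CrossedProduct.U α τ) (J ξ)) := fun ξ => by
    rw [← hτi]
    rfl
  have hT : T ∈ intertwiners (π.twist α τ) π :=
    comp_mem_intertwiners (adjoint_mem_intertwiners hJ) (translate_mem_intertwiners hJ τ)
  have hT' : T ∈ intertwiners π (π.twist α τ) := fun a ξ => by
    have := hT (α τ a) ξ
    simpa [StarRep.twist, ← StarAlgEquiv.mul_apply, ← map_mul, hττ] using this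
  have hTT : T ∘L T ∈ intertwiners π π := comp_mem_intertwiners hT hT'
  have hTsym : ∀ ξ ζ, inner ℂ (T ξ) ζ = inner ℂ ξ (T ζ) := fun ξ ζ => by
    rw [← inner_conj_symm, hTξ, hTξ, hJ', hJ', inner_conj_symm, U_inner_left, hτi]
  obtain ⟨c, hc⟩ := hπ.exists_eq_smul_of_isSelfAdjoint hTT (by
    rw [ContinuousLinearMap.isSelfAdjoint_iff_isSymmetric]
    intro ξ ζ
    change inner ℂ (T (T ξ)) ζ = inner ℂ ξ (T (T ζ))
    rw [hTsym, hTsym])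
  have hcT : ∀ ξ, T (T ξ) = (c : ℂ) • ξ := fun ξ => congr($hc ξ)
  have hT0 : T ζ₀ ≠ 0 := fun h => h0 (by rw [← hJ', ← hTξ, h, inner_zero_right])
  have hc0 : 0 < c := by
    have h1 : (‖T ζ₀‖ : ℂ) ^ 2 = c * (‖ζ₀‖ : ℂ) ^ 2 := by
      have h2 := inner_self_eq_norm_sq_to_K (𝕜 := ℂ) (T ζ₀)
      rw [hTsym, hcT, inner_smul_right, inner_self_eq_norm_sq_to_K] at h2
      exact h2.symm
    have h2 : ‖T ζ₀‖ ^ 2 = c * ‖ζ₀‖ ^ 2 := by exact_mod_cast h1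
    have h3 : 0 < c * ‖ζ₀‖ ^ 2 := by
      rw [← h2]
      positivity
    exact pos_of_mul_pos_left h3 (by positivity)
  set s : ℂ := (Real.sqrt c : ℂ) with hs
  have hss : s * s = c := by
    rw [hs, ← Complex.ofReal_mul, Real.mul_self_sqrt hc0.le]
  have hs0 : s ≠ 0 := by
    intro h
    rw [h, mul_zero] at hss
    exact hc0.ne' (by exact_mod_cast hss.symm)
  set D := (Φ.translate τ⁻¹ J).toContinuousLinearMap ∘L T
  have hD : D ∈ intertwiners π Φ.restrict :=
    comp_mem_intertwiners (translate_mem_intertwiners hJ τ) hT'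
  have hDξ : ∀ ξ, D ξ = Φ (CrossedProduct.U α τ) (J (T ξ)) := fun ξ => by
    rw [← hτi]
    rfl
  -- The two sign choices add up to `2 s J ≠ 0`, so they cannot both vanish.
  obtain ⟨ε, hε, hR0⟩ : ∃ ε : ℂ, ε * ε = 1 ∧ s • J.toContinuousLinearMap + ε • D ≠ 0 := by
    by_contra! h
    have h1 := h 1 (by norm_num)
    have h2 := h (-1) (by norm_num)
    obtain ⟨ξ, hξ⟩ := exists_ne (0 : H₁)
    have h3 : (2 * s) • J ξ = 0 := by
      have e1 : s • J ξ + (1 : ℂ) • D ξ = 0 := congr($h1 ξ)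
      have e2 : s • J ξ + (-1 : ℂ) • D ξ = 0 := congr($h2 ξ)
      calc (2 * s) • J ξ = (s • J ξ + (1 : ℂ) • D ξ) + (s • J ξ + (-1 : ℂ) • D ξ) := by module
        _ = 0 := by rw [e1, e2, add_zero]
    rw [smul_eq_zero] at h3
    exact hξ (J.injective ((h3.resolve_left (by simpa using hs0)).trans (map_zero J).symm))
  set R := s • J.toContinuousLinearMap + ε • D
  have hRξ : ∀ ξ, R ξ = s • J ξ + ε • D ξ := fun _ => rfl
  have hR : R ∈ intertwiners π Φ.restrict :=
    Submodule.add_mem _ (Submodule.smul_mem _ s hJ) (Submodule.smul_mem _ ε hD)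
  obtain ⟨r, L, hr, hL, hRL⟩ := hπ.exists_isometry hR hR0
  have hr0 : (r : ℂ) ≠ 0 := by exact_mod_cast hr.ne'
  have hstab : ∀ g, (∀ ξ, ∃ ζ, Φ (CrossedProduct.U α g) (R ξ) = R ζ) →
      g ∈ Φ.rangeStabilizer L := fun g hg ξ => by
    obtain ⟨ζ, hζ⟩ := hg ξ
    rw [hRL, hRL, map_smul] at hζ
    exact ⟨ζ, smul_right_injective _ hr0 hζ⟩
  -- `U_τ` exchanges the two terms of `R`: `U_τ D = J T` and `D T = c U_τ J`. With `s² = c` and `ε²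
  -- = 1` this gives `U_τ R = R (ε s⁻¹ T)`.
  have hLτ : τ ∈ Φ.rangeStabilizer L := hstab τ fun ξ => ⟨(ε * s⁻¹) • T ξ, by
    have h1 : Φ (CrossedProduct.U α τ) (J ξ) = (s⁻¹ * s⁻¹) • D (T ξ) := by
      rw [hDξ, hcT, ← hss, map_smul, map_smul, smul_smul]
      field_simp
      simp
    have h2 : Φ (CrossedProduct.U α τ) (D ξ) = J (T ξ) := by
      rw [hDξ, U_mul_apply, hττ, U_one_apply]
    rw [map_smul, hRξ, hRξ, map_add, map_smul, map_smul, h1, h2, smul_add, smul_smul, smul_smul,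
      smul_smul, add_comm]
    congr 2
    · field_simp
    · rw [show ε * s⁻¹ * ε = ε * ε * s⁻¹ by ring, hε]
      field_simp⟩
  have hLη : η ∈ Φ.rangeStabilizer L := hstab η fun ξ => by
    obtain ⟨ζ, hζ⟩ := hη ξ
    refine ⟨ζ, ?_⟩
    have h1 : J (T ζ) = Φ (CrossedProduct.U α η⁻¹) (J (T ξ)) := by
      rw [hTξ ζ, ← hζ, U_mul_apply, show τ * η = η⁻¹ * τ by decide, ← U_mul_apply, hP, hTξ]
    rw [hRξ, hRξ, map_add, map_smul, map_smul, hζ, hDξ, hDξ, h1, U_mul_apply, U_mul_apply,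
      show η * τ = τ * η⁻¹ by decide]
  have hLG : ∀ g, g ∈ Φ.rangeStabilizer L := by
    have h : ∀ g : S3, g = 1 ∨ g = η ∨ g = η * η ∨ g = τ ∨ g = η * τ ∨ g = η * η * τ := by decide
    intro g
    rcases h g with rfl | rfl | rfl | rfl | rfl | rfl
    exacts [one_mem _, hLη, mul_mem hLη hLη, hLτ, mul_mem hLη hLτ, mul_mem (mul_mem hLη hLη) hLτ]
  obtain ⟨W, hW⟩ := hΦ.exists_equiv L fun b ξ => by
    obtain ⟨ζ, hζ⟩ := invariant_of_restrict Φ (S := LinearMap.range L.toLinearMap) (by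
      rintro a _ ⟨ξ, rfl⟩
      exact ⟨π a ξ, hL a ξ⟩) (by
      rintro g _ ⟨ξ, rfl⟩
      obtain ⟨ζ, hζ⟩ := hLG g ξ
      exact ⟨ζ, hζ.symm⟩) b (L ξ) ⟨ξ, rfl⟩
    exact ⟨ζ, hζ.symm⟩
  have e : π.UnitarilyEquiv Φ.restrict := ⟨W, fun a ξ => by
    rw [hW, hW]
    exact hL a ξ⟩
  exact ⟨hΦ, e.isIrreducible hπ⟩

theorem IsIrreducible.type_cases (hΦ : Φ.IsIrreducible) :
    IsMinimal Φ ∨ IsTypeTwo Φ ∨ IsTypeThree Φ ∨ IsTypeSix Φ := by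
  obtain ⟨H₁, _, _, _, π, J, hπ, hJ⟩ := hΦ.exists_irreducible_restrict
  by_cases hη : π.UnitarilyEquiv (π.twist α η)
  · obtain ⟨L, hL, hLη⟩ := exists_mem_rangeStabilizer hπ hJ hη
    by_cases h0 : ∀ ξ ζ, inner ℂ (L ξ) (Φ (CrossedProduct.U α τ) (L ζ)) = 0
    · exact .inr (.inl ⟨H₁, _, _, _, π, isTypeTwoFrom hΦ hπ hL hLη h0⟩)
    · push Not at h0
      obtain ⟨ξ, ζ, h0⟩ := h0
      exact .inl (isMinimal_of_inner_ne_zero hΦ hπ hL hLη h0)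
  · by_cases hσ : ∃ σ : S3, σ ≠ 1 ∧ π.UnitarilyEquiv (π.twist α σ)
    · obtain ⟨σ, hσ1, hσ⟩ := hσ
      obtain ⟨L, hL, hLσ⟩ := exists_mem_rangeStabilizer hπ hJ hσ
      refine .inr (.inr (.inl ⟨H₁, _, _, _, π, isTypeThreeFrom hΦ hπ hL hη ⟨hσ1, ?_, ?_⟩ hLσ⟩))
      · rintro rfl
        exact hη hσ
      · rintro rfl
        exact not_unitarilyEquiv_twist_η_sq hη hσ
    · push Not at hσ
      exact .inr (.inr (.inr ⟨H₁, _, _, _, π, isTypeSixFrom hΦ hπ hJ hσ⟩))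

end

end StarRep

/-! ### The dimension of the commutant -/

namespace StarRep

section Commutant

variable {B : Type u} [Semiring B] [StarRing B] [Algebra ℂ B]
  {H : Type v} [NormedAddCommGroup H] [InnerProductSpace ℂ H] [CompleteSpace H]
  {K : Type w} [NormedAddCommGroup K] [InnerProductSpace ℂ K] [CompleteSpace K]
  {π : StarRep B H} {ρ : StarRep B K}

open Classical in
-- Given an equivalence `W`, the operator `W* T` is a scalar for every intertwiner `T`, so `W`
-- spans; with no equivalence only zero remains.
theorem finrank_intertwiners (hπ : π.IsIrreducible) (hρ : ρ.IsIrreducible) :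
    Module.Finite ℂ (intertwiners π ρ) ∧
      Module.finrank ℂ (intertwiners π ρ) = if π.UnitarilyEquiv ρ then 1 else 0 := by
  have := hπ.1
  split_ifs with h
  · obtain ⟨W, hW⟩ := h
    have hW0 : (W : H →L[ℂ] K) ≠ 0 := fun h => by
      obtain ⟨ξ, hξ⟩ := exists_ne (0 : H)
      exact hξ (W.injective (congr($h ξ).trans (map_zero W).symm))
    have hspan : intertwiners π ρ = Submodule.span ℂ {(W : H →L[ℂ] K)} := by
      refine le_antisymm (fun T hT => ?_) ?_
      · obtain ⟨c, hc⟩ := hπ.exists_eq_smul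
          (comp_mem_intertwiners (adjoint_mem_intertwiners (T := (W : H →L[ℂ] K))
            (mem_intertwiners.2 hW)) hT)
        refine Submodule.mem_span_singleton.2 ⟨c, ?_⟩
        ext ξ
        have h1 : W.symm (T ξ) = c • ξ := by
          rw [← show ContinuousLinearMap.adjoint (W : H →L[ℂ] K) (T ξ) = c • ξ from congr($hc ξ),
            LinearIsometryEquiv.adjoint_eq_symm]
          rfl
        rw [W.symm_apply_eq] at h1
        rw [h1, map_smul]
        rfl
      · rw [Submodule.span_singleton_le_iff_mem]
        exact hW
    rw [hspan]
    exact ⟨inferInstance, finrank_span_singleton hW0⟩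
  · have hbot : intertwiners π ρ = ⊥ := by
      rw [eq_bot_iff]
      intro T hT
      by_contra h0
      exact h (hπ.unitarilyEquiv hρ hT h0)
    rw [hbot]
    exact ⟨inferInstance, finrank_bot ℂ _⟩

theorem UnitarilyEquiv.finrank_intertwiners (h : π.UnitarilyEquiv ρ) :
    Module.finrank ℂ (intertwiners π π) = Module.finrank ℂ (intertwiners ρ ρ) := by
  obtain ⟨W, hW⟩ := h
  have hW' : ∀ b ξ, W.symm (ρ b ξ) = π b (W.symm ξ) := fun b ξ => by
    rw [W.symm_apply_eq, hW, W.apply_symm_apply]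
  exact LinearEquiv.finrank_eq
    { toFun := fun T => ⟨(W : H →L[ℂ] K) ∘L (T : H →L[ℂ] H) ∘L (W.symm : K →L[ℂ] H), fun b ξ => by
        change W (T.1 (W.symm (ρ b ξ))) = ρ b (W (T.1 (W.symm ξ)))
        rw [hW', T.2, hW]⟩
      map_add' := fun S T => by
        ext ξ
        simp
      map_smul' := fun c T => by
        ext ξ
        simp
      invFun := fun T => ⟨(W.symm : K →L[ℂ] H) ∘L (T : K →L[ℂ] K) ∘L (W : H →L[ℂ] K), fun b ξ => by
        change W.symm (T.1 (W (π b ξ))) = π b (W.symm (T.1 (W ξ)))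
        rw [hW, T.2, hW']⟩
      left_inv := fun T => by
        ext ξ
        simp
      right_inv := fun T => by
        ext ξ
        simp }

/-- The inclusion of a summand into a finite direct sum of copies of a Hilbert space. -/
def inclusion (H : Type v) [NormedAddCommGroup H] [InnerProductSpace ℂ H] {n : ℕ} (j : Fin n) :
    H →L[ℂ] PiLp 2 fun _ : Fin n => H :=
  (PiLp.continuousLinearEquiv 2 ℂ fun _ : Fin n => H).symm.toContinuousLinearMap ∘L
    ContinuousLinearMap.single ℂ (fun _ : Fin n => H) j

theorem inclusion_apply {n : ℕ} (i j : Fin n) (ξ : H) :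
    inclusion H j ξ i = if i = j then ξ else 0 := by
  change (Pi.single j ξ : Fin n → H) i = _
  rw [Pi.single_apply]

theorem sum_inclusion {n : ℕ} (ξ : PiLp 2 fun _ : Fin n => H) :
    ∑ i, inclusion H i (ξ i) = ξ := by
  ext j
  rw [WithLp.ofLp_sum, Finset.sum_apply]
  simp [inclusion_apply]

/-- The commutant of a direct sum is the space of matrices of intertwiners. -/
def intertwinersEquiv {n : ℕ} {ρ : StarRep B (PiLp 2 fun _ : Fin n => H)} {π : Fin n → StarRep B H}
    (h : ρ.IsDirectSum π) :
    intertwiners ρ ρ ≃ₗ[ℂ] ∀ i j, intertwiners (π j) (π i) :=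
  have hinc : ∀ b j ξ, inclusion H j (π j b ξ) = ρ b (inclusion H j ξ) := fun b j ξ => by
    ext i
    rw [h, inclusion_apply, inclusion_apply]
    by_cases hij : i = j
    · subst hij
      simp
    · simp [hij]
  { toFun := fun T i j => ⟨PiLp.proj 2 (fun _ : Fin n => H) i ∘L T.1 ∘L inclusion H j,
      fun b ξ => by
        change T.1 (inclusion H j (π j b ξ)) i = π i b (T.1 (inclusion H j ξ) i)
        rw [hinc, T.2, h]⟩
    map_add' := fun S T => by
      ext i j ξ
      simp
    map_smul' := fun c T => by
      ext i j ξ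
      simp
    invFun := fun S => ⟨∑ i, ∑ j, inclusion H i ∘L (S i j).1 ∘L PiLp.proj 2 (fun _ : Fin n => H) j,
      Submodule.sum_mem _ fun i _ => Submodule.sum_mem _ fun j _ => fun b ξ => by
        change inclusion H i ((S i j).1 (ρ b ξ j)) = ρ b (inclusion H i ((S i j).1 (ξ j)))
        rw [h, (S i j).2, hinc]⟩
    left_inv := fun T => by
      ext1
      ext1 ξ
      simp only [sum_apply]
      change ∑ i, ∑ j, inclusion H i (T.1 (inclusion H j (ξ j)) i) = T.1 ξ
      rw [Finset.sum_comm]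
      simp only [sum_inclusion]
      rw [← map_sum, sum_inclusion]
    right_inv := fun S => by
      ext i j ξ
      change (∑ k, ∑ l, inclusion H k ∘L (S k l).1 ∘L PiLp.proj 2 (fun _ : Fin n => H) l)
        (inclusion H j ξ) i = (S i j).1 ξ
      simp only [sum_apply, WithLp.ofLp_sum, Finset.sum_apply]
      change ∑ k, ∑ l, inclusion H k ((S k l).1 (inclusion H j ξ l)) i = _
      simp only [inclusion_apply]
      rw [Finset.sum_eq_single i, Finset.sum_eq_single j]
      · simp
      · intro l _ hl
        simp [hl]
      · simp
      · intro k _ hk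
        simp [Ne.symm hk]
      · simp }

open Classical in
theorem IsDirectSum.finrank_intertwiners {n : ℕ} {ρ : StarRep B (PiLp 2 fun _ : Fin n => H)}
    {π : Fin n → StarRep B H} (h : ρ.IsDirectSum π) (hπ : ∀ i, (π i).IsIrreducible) :
    Module.finrank ℂ (intertwiners ρ ρ) =
      ∑ i, ∑ j, if (π j).UnitarilyEquiv (π i) then 1 else 0 := by
  have := fun i j => (StarRep.finrank_intertwiners (hπ i) (hπ j)).1
  rw [(intertwinersEquiv h).finrank_eq, Module.finrank_pi_fintype]
  refine Finset.sum_congr rfl fun i _ => ?_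
  rw [Module.finrank_pi_fintype]
  exact Finset.sum_congr rfl fun j _ => (StarRep.finrank_intertwiners (hπ j) (hπ i)).2

theorem UnitarilyEquiv.refl (π : StarRep B H) : π.UnitarilyEquiv π :=
  ⟨LinearIsometryEquiv.refl ℂ H, fun _ _ => rfl⟩

/-- The commutant of a direct sum of `n` inequivalent irreducible representations has
dimension `n`. -/
theorem IsDirectSum.finrank_intertwiners_of_pairwise {n : ℕ}
    {ρ : StarRep B (PiLp 2 fun _ : Fin n => H)}
    {π : Fin n → StarRep B H} (h : ρ.IsDirectSum π) (hπ : ∀ i, (π i).IsIrreducible)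
    (hne : ∀ i j, i ≠ j → ¬ (π i).UnitarilyEquiv (π j)) :
    Module.finrank ℂ (intertwiners ρ ρ) = n := by
  classical
  rw [h.finrank_intertwiners hπ]
  calc _ = ∑ i : Fin n, 1 := Finset.sum_congr rfl fun i _ => by
        rw [Finset.sum_eq_single i]
        · simp [UnitarilyEquiv.refl]
        · exact fun j _ hj => if_neg (hne j i hj)
        · simp
    _ = n := by simp

end Commutant

/-! ### Commutant dimensions of the four types, and their mutual exclusion -/

section Types

variable {A : Type u} [CStarAlgebra A] {α : S3 →* (A ≃⋆ₐ[ℂ] A)}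
  {H : Type v} [NormedAddCommGroup H] [InnerProductSpace ℂ H] [CompleteSpace H]
  {Φ : StarRep (CrossedProduct α) H}
  {H₁ : Type v} [NormedAddCommGroup H₁] [InnerProductSpace ℂ H₁] [CompleteSpace H₁]
  {π : StarRep A H₁}

theorem UnitarilyEquiv.restrict {K : Type w} [NormedAddCommGroup K] [InnerProductSpace ℂ K]
    [CompleteSpace K] {Ψ : StarRep (CrossedProduct α) K} (h : Φ.UnitarilyEquiv Ψ) :
    Φ.restrict.UnitarilyEquiv Ψ.restrict := by
  obtain ⟨W, hW⟩ := h
  exact ⟨W, fun a ξ => hW _ ξ⟩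

theorem finrank_commutant_of_isMinimal (h : IsMinimal Φ) :
    Module.finrank ℂ (intertwiners Φ.restrict Φ.restrict) = 1 := by
  classical
  rw [(finrank_intertwiners h.2 h.2).2, if_pos (UnitarilyEquiv.refl _)]

/-- The value is 4 exactly when `π₁` and `π₁ ∘ α_τ` are equivalent. Neither value occurs for another
type. -/
theorem finrank_commutant_of_isTypeTwo (h : IsTypeTwo Φ) :
    Module.finrank ℂ (intertwiners Φ.restrict Φ.restrict) = 2 ∨
      Module.finrank ℂ (intertwiners Φ.restrict Φ.restrict) = 4 := by
  classical
  obtain ⟨H₁, _, _, _, π, hπ, ⟨Φ', hΦ', hsum, -⟩, -⟩ := h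
  rw [hΦ'.restrict.finrank_intertwiners, hsum.finrank_intertwiners fun i => by
    fin_cases i
    exacts [hπ, hπ.twist α τ]]
  by_cases h : π.UnitarilyEquiv (π.twist α τ)
  · right
    simp only [Fin.sum_univ_two]
    simp [UnitarilyEquiv.refl, h, h.symm]
  · left
    have h' : ¬ (π.twist α τ).UnitarilyEquiv π := fun h' => h h'.symm
    simp only [Fin.sum_univ_two]
    simp [UnitarilyEquiv.refl, h, h']

theorem finrank_commutant_of_isTypeThree (h : IsTypeThree Φ) :
    Module.finrank ℂ (intertwiners Φ.restrict Φ.restrict) = 3 := by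
  obtain ⟨H₁, _, _, _, π, hπ, hη, hη2, Φ', hΦ', hsum, -⟩ := h
  let g : Fin 3 → S3 := ![1, η, η ^ 2]
  have hg : ∀ i j, i ≠ j → g j * (g i)⁻¹ = η ∨ g j * (g i)⁻¹ = η ^ 2 := by decide
  have hgt : ![π, π.twist α η, π.twist α (η ^ 2)] = fun i => π.twist α (g i) := by
    funext i
    fin_cases i <;> simp [g, twist_one]
  rw [hgt] at hsum
  rw [hΦ'.restrict.finrank_intertwiners]
  refine hsum.finrank_intertwiners_of_pairwise (fun i => hπ.twist α _) fun i j hij e => ?_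
  have := e.twist_mul_inv
  rcases hg i j hij with h | h <;> rw [h] at this
  exacts [hη this, hη2 this]

theorem finrank_commutant_of_isTypeSix (h : IsTypeSix Φ) :
    Module.finrank ℂ (intertwiners Φ.restrict Φ.restrict) = 6 := by
  obtain ⟨H₁, _, _, _, π, hπ, hσ, Φ', hΦ', hsum, -⟩ := h
  let g : Fin 6 → S3 := ![1, η, η ^ 2, τ, η * τ, η ^ 2 * τ]
  have hg : ∀ i j, i ≠ j → g j * (g i)⁻¹ ≠ 1 := by decide
  have hgt : ![π, π.twist α η, π.twist α (η ^ 2), π.twist α τ, π.twist α (η * τ),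
      π.twist α (η ^ 2 * τ)] = fun i => π.twist α (g i) := by
    funext i
    fin_cases i <;> simp [g, twist_one]
  rw [hgt] at hsum
  rw [hΦ'.restrict.finrank_intertwiners]
  exact hsum.finrank_intertwiners_of_pairwise (fun i => hπ.twist α _) fun i j hij e =>
    hσ _ (hg i j hij) e.twist_mul_inv

theorem IsIrreducible.existsUnique_type (hΦ : Φ.IsIrreducible) :
    ∃! k : Fin 4, ![IsMinimal Φ, IsTypeTwo Φ, IsTypeThree Φ, IsTypeSix Φ] k := by
  -- The list reads the type off the dimension: 1, 2, 3, 4, 6 go to 0, 1, 2, 1, 3. The entries at 0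
  -- and 5 are fillers.
  have hdim : ∀ k : Fin 4, ![IsMinimal Φ, IsTypeTwo Φ, IsTypeThree Φ, IsTypeSix Φ] k →
      k = ![0, 0, 1, 2, 1, 0, 3] (Fin.ofNat 7
        (Module.finrank ℂ (intertwiners Φ.restrict Φ.restrict))) := by
    intro k hk
    fin_cases k
    · rw [finrank_commutant_of_isMinimal hk]
      rfl
    · rcases finrank_commutant_of_isTypeTwo hk with h | h <;> rw [h] <;> rfl
    · rw [finrank_commutant_of_isTypeThree hk]
      rfl
    · rw [finrank_commutant_of_isTypeSix hk]
      rfl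
  refine existsUnique_of_exists_of_unique ?_ fun k l hk hl => (hdim k hk).trans (hdim l hl).symm
  rcases hΦ.type_cases with h | h | h | h
  exacts [⟨0, h⟩, ⟨1, h⟩, ⟨2, h⟩, ⟨3, h⟩]

end Types

end StarRep

/-! ### Examples of the second type -/

namespace StarRep

/-- The permutation representation on `ℂⁿ`. -/
def permUnitary (n : ℕ) : Equiv.Perm (Fin n) →*
    unitary (EuclideanSpace ℂ (Fin n) →L[ℂ] EuclideanSpace ℂ (Fin n)) :=
  Unitary.linearIsometryEquiv.symm.toMonoidHom.comp
    { toFun := fun σ => LinearIsometryEquiv.piLpCongrLeft 2 ℂ ℂ σ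
      map_one' := by
        ext ξ i
        simp [Equiv.piCongrLeft']
        rfl
      map_mul' := fun σ ρ => by
        ext ξ i
        simp [Equiv.piCongrLeft']
        rfl }

/-- The operator on `ℂⁿ` permuting the coordinates. -/
def permCLM (n : ℕ) (σ : Equiv.Perm (Fin n)) :
    EuclideanSpace ℂ (Fin n) →L[ℂ] EuclideanSpace ℂ (Fin n) :=
  permUnitary n σ

theorem coe_permUnitary (n : ℕ) (σ : Equiv.Perm (Fin n)) :
    (permUnitary n σ : EuclideanSpace ℂ (Fin n) →L[ℂ] EuclideanSpace ℂ (Fin n)) =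
      permCLM n σ := rfl

theorem permCLM_apply {n : ℕ} (σ : Equiv.Perm (Fin n)) (ξ : EuclideanSpace ℂ (Fin n))
    (i : Fin n) : permCLM n σ ξ i = ξ (σ⁻¹ i) := rfl

theorem permCLM_single {n : ℕ} (σ : Equiv.Perm (Fin n)) (i : Fin n) :
    permCLM n σ (EuclideanSpace.single i 1) =
      EuclideanSpace.single (σ i) 1 := by
  ext j
  rw [permCLM_apply, PiLp.single_apply, PiLp.single_apply]
  exact if_congr Equiv.Perm.inv_eq_iff_eq rfl rfl

/-! ### Type (ii) with equivalent summands: trivial action on `ℂ` -/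

section Trivial

/-- The vectors of `ℂ³` with coordinates adding up to zero. -/
def sumZero : Submodule ℂ (EuclideanSpace ℂ (Fin 3)) where
  carrier := {ξ | ∑ i, ξ i = 0}
  add_mem' {ξ ζ} hξ hζ := by
    simp only [Set.mem_ofPred_eq] at *
    simp [Finset.sum_add_distrib, hξ, hζ]
  zero_mem' := by simp
  smul_mem' c ξ hξ := by
    simp only [Set.mem_ofPred_eq] at *
    simp [← Finset.mul_sum, hξ]

/-- A nonzero sum-zero vector has two distinct coordinates; subtracting its image under their swap
leaves a multiple of `e_i - e_j`. Double transitivity then yields all such differences, which span.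
-/
theorem eq_sumZero {T : Submodule ℂ (EuclideanSpace ℂ (Fin 3))} (hT : T ≤ sumZero) (h0 : T ≠ ⊥)
    (hinv : ∀ σ, ∀ ξ ∈ T, permCLM 3 σ ξ ∈ T) :
    T = sumZero := by
  refine le_antisymm hT fun ξ hξ => ?_
  obtain ⟨v, hv, hv0⟩ := (Submodule.ne_bot_iff T).1 h0
  obtain ⟨i, j, hij⟩ : ∃ i j, v i ≠ v j := by
    by_contra! h
    have hs : ∑ i, v i = 0 := hT hv
    simp only [h _ 0, Finset.sum_const, Finset.card_univ, Fintype.card_fin, nsmul_eq_mul] at hs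
    refine hv0 ?_
    ext k
    rw [h k 0]
    simpa using hs
  have hne : i ≠ j := fun h => hij (by rw [h])
  have hd : EuclideanSpace.single i (1 : ℂ) - EuclideanSpace.single j 1 ∈ T := by
    have h1 := T.sub_mem hv (hinv (Equiv.swap i j) v hv)
    have h2 : v - permCLM 3 (Equiv.swap i j) v =
        (v i - v j) • (EuclideanSpace.single i (1 : ℂ) - EuclideanSpace.single j 1) := by
      ext k
      by_cases hki : k = i
      · subst hki
        simp [permCLM_apply, hne]
      · by_cases hkj : k = j
        · subst hkj
          simp [permCLM_apply, hki]
        · simp [permCLM_apply, hki, hkj, Equiv.swap_apply_of_ne_of_ne hki hkj]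
    rw [h2] at h1
    exact (T.smul_mem_iff (sub_ne_zero.2 hij)).1 h1
  have hall : ∀ k l, k ≠ l →
      EuclideanSpace.single k (1 : ℂ) - EuclideanSpace.single l 1 ∈ T := fun k l hkl => by
    have : ∀ i j k l : Fin 3, i ≠ j → k ≠ l → ∃ σ : S3, σ i = k ∧ σ j = l := by decide
    obtain ⟨σ, rfl, rfl⟩ := this i j k l hne hkl
    simpa [permCLM_single] using hinv σ _ hd
  have hs : ∑ i, ξ i = 0 := hξ
  rw [Fin.sum_univ_three] at hs
  have : ξ = ξ 0 • (EuclideanSpace.single 0 (1 : ℂ) - EuclideanSpace.single 2 1) +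
      ξ 1 • (EuclideanSpace.single 1 (1 : ℂ) - EuclideanSpace.single 2 1) := by
    ext k
    fin_cases k
    · simp
    · simp
    · simp
      linear_combination hs
  rw [this]
  exact T.add_mem (T.smul_mem _ (hall 0 2 (by decide))) (T.smul_mem _ (hall 1 2 (by decide)))

/-- The representation on sum-zero vectors in `ℂ³`. The action being trivial, every twist of `π` is
`π`, which rules out types (iii) and (iv). -/
theorem exists_isTypeTwoFrom_equiv :
    ∃ (A : Type) (_ : CStarAlgebra A) (α : S3 →* (A ≃⋆ₐ[ℂ] A))
      (H : Type) (_ : NormedAddCommGroup H) (_ : InnerProductSpace ℂ H) (_ : CompleteSpace H)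
      (Φ : StarRep (CrossedProduct α) H)
      (H₁ : Type) (_ : NormedAddCommGroup H₁) (_ : InnerProductSpace ℂ H₁) (_ : CompleteSpace H₁)
      (π₁ : StarRep A H₁),
      Φ.IsIrreducible ∧ IsTypeTwoFrom Φ π₁ ∧ π₁.UnitarilyEquiv (π₁.twist α τ) := by
  have : CompleteSpace sumZero := FiniteDimensional.complete ℂ sumZero
  obtain ⟨Ψ, ⟨-, hΨ⟩, -⟩ := CrossedProduct.existsUnique_lift (1 : S3 →* (ℂ ≃⋆ₐ[ℂ] ℂ))
    (StarAlgHom.ofId ℂ (EuclideanSpace ℂ (Fin 3) →L[ℂ] EuclideanSpace ℂ (Fin 3)))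
    (permUnitary 3) fun g a => by
      rw [show StarAlgHom.ofId ℂ (EuclideanSpace ℂ (Fin 3) →L[ℂ] EuclideanSpace ℂ (Fin 3)) a =
        algebraMap ℂ _ a from rfl, ← Algebra.commutes, mul_assoc, ← Submonoid.coe_mul, ← map_mul,
        mul_inv_cancel, map_one, OneMemClass.coe_one, mul_one]
      rfl
  have hS : ∀ b (ξ : sumZero), ∃ ζ : sumZero, Ψ b (sumZero.subtypeₗᵢ ξ) =
      sumZero.subtypeₗᵢ ζ := fun b ξ => by
    refine ⟨⟨_, invariant_of_restrict Ψ (S := sumZero) (fun a ξ hξ => ?_) (fun g ξ hξ => ?_) b ξ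
      ξ.2⟩, rfl⟩
    · have : restrict Ψ a ξ = a • ξ := by
        rw [show restrict Ψ a = a • 1 from by
          rw [← map_one (restrict Ψ), ← map_smul, smul_eq_mul, mul_one]]
        rfl
      rw [this]
      exact sumZero.smul_mem a hξ
    · rw [hΨ, coe_permUnitary]
      change ∑ i, ξ (g⁻¹ i) = 0
      rw [Equiv.sum_comp g⁻¹ fun i => ξ i]
      exact hξ
  set Φ : StarRep _ sumZero := compress Ψ sumZero.subtypeₗᵢ hS
  have hΦU : ∀ g (ξ : sumZero), (Φ (CrossedProduct.U _ g) ξ : EuclideanSpace ℂ (Fin 3)) =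
      permCLM 3 g ξ := fun g ξ => by
    rw [← coe_permUnitary, ← hΨ]
    exact compress_apply Ψ sumZero.subtypeₗᵢ hS _ ξ
  have hx : EuclideanSpace.single 0 (1 : ℂ) - EuclideanSpace.single 1 1 ∈ sumZero := by
    change ∑ i, _ = _
    simp
  have hy : EuclideanSpace.single 0 (1 : ℂ) + EuclideanSpace.single 1 1 -
      (2 : ℂ) • EuclideanSpace.single 2 1 ∈ sumZero := by
    change ∑ i, _ = _
    simp [Fin.sum_univ_three]
    norm_num
  have hΦ : Φ.IsIrreducible := by
    refine isIrreducible_compress_subtype Ψ sumZero hS (fun h => ?_) fun T _ hT hle h0 =>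
      eq_sumZero hle h0 fun σ ξ hξ => by
        rw [← coe_permUnitary, ← hΨ]
        exact hT _ ξ hξ
    rw [h, Submodule.mem_bot] at hx
    have := congr(($hx) 0)
    simp at this
  have htw : ∀ {H₁ : Type} [NormedAddCommGroup H₁] [InnerProductSpace ℂ H₁] [CompleteSpace H₁]
      (π : StarRep ℂ H₁) (g : S3), π.UnitarilyEquiv (π.twist 1 g) := fun π g =>
    UnitarilyEquiv.refl π
  rcases hΦ.type_cases with h | h | h | h
  -- Here `U_τ` commutes with `A`, so minimality would make it a scalar; but it has eigenvalue `-1`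
  -- on `(1, -1, 0)` and `1` on `(1, 1, -2)`.
  · obtain ⟨c, hc⟩ := h.2.exists_eq_smul (T := Φ (CrossedProduct.U _ τ)) fun a ξ =>
      U_restrict_apply Φ τ a ξ
    have h1 := congr(($(hΦU τ ⟨_, hx⟩)) 0)
    have h2 := congr(($(hΦU τ ⟨_, hy⟩)) 0)
    rw [hc, permCLM_apply, show τ⁻¹ 0 = 1 by decide] at h1 h2
    have h3 : c = -1 := by simpa using h1
    have h4 : c = 1 := by simpa using h2
    rw [h3] at h4
    norm_num at h4
  · obtain ⟨H₁, _, _, _, π, h⟩ := h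
    exact ⟨ℂ, _, 1, _, _, _, _, Φ, H₁, _, _, _, π, hΦ, h, htw π τ⟩
  · obtain ⟨H₁, _, _, _, π, h⟩ := h
    exact absurd (htw π η) h.2.1
  · obtain ⟨H₁, _, _, _, π, h⟩ := h
    exact absurd (htw π η) (h.2.1 η (by decide))

end Trivial

/-! ### Type (ii) with inequivalent summands: the flip of `ℂ²` through the sign -/

section Sign

/-- The homomorphism from `𝔖₃` sending even permutations to `1` and odd ones to an element of
order two. -/
def signHom {M : Type*} [Group M] (x : M) (hx : x * x = 1) : S3 →* M where
  toFun g := if Equiv.Perm.sign g = 1 then 1 else x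
  map_one' := by simp
  map_mul' g h := by
    rcases Int.units_eq_one_or (Equiv.Perm.sign g) with hg | hg <;>
      rcases Int.units_eq_one_or (Equiv.Perm.sign h) with hh | hh <;>
        simp [hg, hh, hx, show (-1 : ℤˣ) ≠ 1 by decide]

theorem signHom_cases {M : Type*} [Group M] (x : M) (hx : x * x = 1) (g : S3) :
    Equiv.Perm.sign g = 1 ∧ signHom x hx g = 1 ∨ Equiv.Perm.sign g ≠ 1 ∧ signHom x hx g = x := by
  by_cases h : Equiv.Perm.sign g = 1 <;> simp [signHom, h]

/-- The flip of `ℂ × ℂ`. -/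
def flip : (Fin 2 → ℂ) ≃⋆ₐ[ℂ] (Fin 2 → ℂ) where
  toFun a := a ∘ Equiv.swap 0 1
  invFun a := a ∘ Equiv.swap 0 1
  left_inv a := by
    ext i
    simp
  right_inv a := by
    ext i
    simp
  map_mul' a b := rfl
  map_add' a b := rfl
  map_star' a := rfl
  map_smul' c a := rfl

/-- The diagonal operators on `ℂ²`. -/
def diagonalRep : StarRep (Fin 2 → ℂ) (EuclideanSpace ℂ (Fin 2)) :=
  ((Matrix.toEuclideanCLM (n := Fin 2) (𝕜 := ℂ) :
      Matrix (Fin 2) (Fin 2) ℂ ≃⋆ₐ[ℂ] _) : Matrix (Fin 2) (Fin 2) ℂ →⋆ₐ[ℂ] _).comp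
    { Matrix.diagonalAlgHom ℂ with
      map_star' := fun a => by
        simp [Matrix.star_eq_conjTranspose, Matrix.diagonal_conjTranspose] }

theorem diagonalRep_apply (a : Fin 2 → ℂ) (ξ : EuclideanSpace ℂ (Fin 2)) (i : Fin 2) :
    diagonalRep a ξ i = a i * ξ i := by
  change Matrix.toEuclideanCLM (𝕜 := ℂ) (Matrix.diagonal a) ξ i = _
  simp [Matrix.ofLp_toEuclideanCLM, Matrix.mulVec_diagonal]

/-- Diagonal operators and the coordinate swap act irreducibly on `ℂ²`. As `α_η` is trivial, types
(iii) and (iv) are excluded; as `A` is commutative, its irreducible representations are scalar, so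
`Φ` is not minimal. -/
theorem exists_isTypeTwoFrom_not_equiv :
    ∃ (A : Type) (_ : CStarAlgebra A) (α : S3 →* (A ≃⋆ₐ[ℂ] A))
      (H : Type) (_ : NormedAddCommGroup H) (_ : InnerProductSpace ℂ H) (_ : CompleteSpace H)
      (Φ : StarRep (CrossedProduct α) H)
      (H₁ : Type) (_ : NormedAddCommGroup H₁) (_ : InnerProductSpace ℂ H₁) (_ : CompleteSpace H₁)
      (π₁ : StarRep A H₁),
      Φ.IsIrreducible ∧ IsTypeTwoFrom Φ π₁ ∧ ¬ π₁.UnitarilyEquiv (π₁.twist α τ) := by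
  have hflip : flip * flip = 1 := by
    ext a i
    exact congrFun (flip.left_inv a) i
  have hswap : Equiv.swap (0 : Fin 2) 1 * Equiv.swap 0 1 = 1 := by decide
  set α : S3 →* ((Fin 2 → ℂ) ≃⋆ₐ[ℂ] (Fin 2 → ℂ)) := signHom flip hflip with hα
  obtain ⟨Φ, ⟨hΦA, hΦU⟩, -⟩ := CrossedProduct.existsUnique_lift α diagonalRep
    ((permUnitary 2).comp (signHom (Equiv.swap 0 1) hswap)) fun g a => by
      ext ξ i
      simp only [mul_apply_eq_comp, MonoidHom.comp_apply, coe_permUnitary, permCLM_apply,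
        diagonalRep_apply]
      rw [map_inv, inv_inv, ← Equiv.Perm.mul_apply, mul_inv_cancel, Equiv.Perm.one_apply, hα]
      rcases signHom_cases flip hflip g with ⟨hg, h⟩ | ⟨hg, h⟩ <;>
        rcases signHom_cases _ hswap g with ⟨hg', h'⟩ | ⟨hg', h'⟩
      · rw [h, h']
        simp
      · exact absurd hg hg'
      · exact absurd hg' hg
      · rw [h, h']
        simp [flip]
  have hατ : α τ = flip := by simp [hα, signHom, τ]
  have hαη : α η = 1 := by
    rw [hα, signHom]
    simp [show Equiv.Perm.sign η = 1 by decide]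
  have hΦ : IsIrreducible Φ := by
    refine ⟨inferInstance, fun T _ hT => or_iff_not_imp_left.2 fun h0 => ?_⟩
    have hdiag : ∀ a, ∀ ξ ∈ T, diagonalRep a ξ ∈ T := fun a ξ hξ => hΦA a ▸ hT _ ξ hξ
    have hperm : ∀ ξ ∈ T,
        permCLM 2 (Equiv.swap 0 1) ξ ∈ T :=
      fun ξ hξ => by
        have := hT (CrossedProduct.U α τ) ξ hξ
        rw [hΦU, MonoidHom.comp_apply, coe_permUnitary] at this
        simpa [signHom, τ] using this
    obtain ⟨v, hv, hv0⟩ := (Submodule.ne_bot_iff T).1 h0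
    obtain ⟨i, hi⟩ : ∃ i, v i ≠ 0 := by
      by_contra! h
      exact hv0 (by ext k; exact h k)
    have h1 : EuclideanSpace.single i (1 : ℂ) ∈ T := by
      have := hdiag (Pi.single i (v i)⁻¹) v hv
      convert this
      ext k
      rw [diagonalRep_apply]
      by_cases hk : k = i
      · subst hk
        simp [hi]
      · simp [hk]
    have h2 : ∀ k, EuclideanSpace.single k (1 : ℂ) ∈ T := fun k => by
      have h3 := hperm _ h1
      rw [permCLM_single] at h3
      have : ∀ i k : Fin 2, k = i ∨ k = Equiv.swap 0 1 i := by decide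
      rcases this i k with rfl | rfl
      exacts [h1, h3]
    rw [eq_top_iff]
    intro ξ _
    have : ξ = ξ 0 • EuclideanSpace.single 0 (1 : ℂ) + ξ 1 • EuclideanSpace.single 1 (1 : ℂ) := by
      ext k
      fin_cases k <;> simp
    rw [this]
    exact T.add_mem (T.smul_mem _ (h2 0)) (T.smul_mem _ (h2 1))
  have hcomm : ∀ {H₁ : Type} [NormedAddCommGroup H₁] [InnerProductSpace ℂ H₁] [CompleteSpace H₁]
      (π : StarRep (Fin 2 → ℂ) H₁), π.IsIrreducible → ∀ a, ∃ c : ℂ, π a = c • 1 := by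
    intro H₁ _ _ _ π hπ a
    refine hπ.exists_eq_smul fun b ξ => ?_
    rw [← mul_apply_eq_comp, ← mul_apply_eq_comp, ← map_mul, ← map_mul, mul_comm]
  have htw : ∀ {H₁ : Type} [NormedAddCommGroup H₁] [InnerProductSpace ℂ H₁] [CompleteSpace H₁]
      (π : StarRep (Fin 2 → ℂ) H₁), π.UnitarilyEquiv (π.twist α η) := fun π =>
    ⟨LinearIsometryEquiv.refl ℂ _, fun a ξ => by simp [StarRep.twist, hαη]⟩
  rcases IsIrreducible.type_cases hΦ with h | h | h | h
  · obtain ⟨c, hc⟩ := hcomm (restrict Φ) h.2 ![1, 0]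
    have hd : restrict Φ ![1, 0] = diagonalRep ![1, 0] := hΦA _
    rw [hd] at hc
    have h1 := diagonalRep_apply ![1, 0] (EuclideanSpace.single 0 1) 0
    have h2 := diagonalRep_apply ![1, 0] (EuclideanSpace.single 1 1) 1
    rw [hc] at h1 h2
    simp at h1 h2
    exact (zero_ne_one (h2.symm.trans h1)).elim
  · obtain ⟨H₁, _, _, _, π, h⟩ := h
    refine ⟨_, _, α, _, _, _, _, Φ, H₁, _, _, _, π, hΦ, h, ?_⟩
    -- An equivalence would force the scalar `c` of the projection `(1, 0)` to equal that of its
    -- flip, `1 - c`; yet `c² = c`, so `c = 1/2` is impossible.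
    rintro ⟨W, hW⟩
    have := h.1.1
    obtain ⟨c, hc⟩ := hcomm π h.1 ![1, 0]
    obtain ⟨ξ, hξ⟩ := exists_ne (0 : H₁)
    have h1 : c * c = c := by
      have h2 : π ![1, 0] * π ![1, 0] = π ![1, 0] := by
        rw [← map_mul]
        congr 1
        ext i
        fin_cases i <;> simp
      rw [hc] at h2
      have h3 : (c * c) • ξ = c • ξ := by
        rw [mul_smul]
        exact congr($h2 ξ)
      exact smul_left_injective ℂ hξ h3
    have h2 : π (flip ![1, 0]) = (1 - c) • 1 := by
      have : flip ![1, 0] = 1 - ![1, 0] := by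
        ext i
        fin_cases i <;> simp [flip]
      rw [this, map_sub, map_one, hc, sub_smul, one_smul]
    have h3 : c • W ξ = (1 - c) • W ξ := by
      have := hW ![1, 0] ξ
      rw [StarRep.twist, hc] at this
      change W (c • ξ) = π (α τ ![1, 0]) (W ξ) at this
      rw [hατ, h2, map_smul] at this
      exact this
    have h4 : c = 1 - c :=
      smul_left_injective ℂ (fun h => hξ (W.injective (h.trans (map_zero W).symm))) h3
    have h5 : c = 1 / 2 := by linear_combination h4 / 2
    rw [h5] at h1
    norm_num at h1
  · obtain ⟨H₁, _, _, _, π, h⟩ := h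
    exact absurd (htw π) h.2.1
  · obtain ⟨H₁, _, _, _, π, h⟩ := h
    exact absurd (htw π) (h.2.1 η (by decide))

end Sign

end StarRep

end

theorem mainTheorem6 :
    Subgroup.closure {τ, η} = (⊤ : Subgroup S3) ∧
    (∀ (A : Type u) [CStarAlgebra A] (α : S3 →* (A ≃⋆ₐ[ℂ] A))
      (H : Type v) [NormedAddCommGroup H] [InnerProductSpace ℂ H] [CompleteSpace H]
      (Φ : StarRep (CrossedProduct α) H), Φ.IsIrreducible →
      ∃! k : Fin 4, ![IsMinimal Φ, IsTypeTwo Φ, IsTypeThree Φ, IsTypeSix Φ] k) ∧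
    -- in the second type, `π₁` and `π₁ ∘ α_τ` may be equivalent, or not
    (∃ (A : Type) (_ : CStarAlgebra A) (α : S3 →* (A ≃⋆ₐ[ℂ] A))
      (H : Type) (_ : NormedAddCommGroup H) (_ : InnerProductSpace ℂ H) (_ : CompleteSpace H)
      (Φ : StarRep (CrossedProduct α) H)
      (H₁ : Type) (_ : NormedAddCommGroup H₁) (_ : InnerProductSpace ℂ H₁) (_ : CompleteSpace H₁)
      (π₁ : StarRep A H₁),
      Φ.IsIrreducible ∧ IsTypeTwoFrom Φ π₁ ∧ π₁.UnitarilyEquiv (π₁.twist α τ)) ∧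
    (∃ (A : Type) (_ : CStarAlgebra A) (α : S3 →* (A ≃⋆ₐ[ℂ] A))
      (H : Type) (_ : NormedAddCommGroup H) (_ : InnerProductSpace ℂ H) (_ : CompleteSpace H)
      (Φ : StarRep (CrossedProduct α) H)
      (H₁ : Type) (_ : NormedAddCommGroup H₁) (_ : InnerProductSpace ℂ H₁) (_ : CompleteSpace H₁)
      (π₁ : StarRep A H₁),
      Φ.IsIrreducible ∧ IsTypeTwoFrom Φ π₁ ∧ ¬ π₁.UnitarilyEquiv (π₁.twist α τ)) := by
  refine ⟨closure_τ_η, ?_, StarRep.exists_isTypeTwoFrom_equiv,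
    StarRep.exists_isTypeTwoFrom_not_equiv⟩
  intro A _ α H _ _ _ Φ hΦ
  exact StarRep.IsIrreducible.existsUnique_type hΦ
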